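/- Let $K$ be a field with an automorphism $\theta$ of finite order $r$, and let $F = K^{\theta}$. Let $\mathcal A = K[X^{\pm 1};\theta]$ be the ring of skew Laurent polynomials ($Xa = \theta(a)X$ for $a\in K$) and put $Y = X^r$, so that $F[Y]$ is central in $\mathcal A$. Let $\mathrm{Frac}(\mathcal A)$ be the skew field of fractions $g/D$ with $g \in \mathcal A$ and $0 \ne D \in F[Y]$. Fix a separable closure $F^{\mathrm s}$ of $F$. For $z \in F^{\mathrm s}$, $z\neq 0$, with minimal polynomial $N\in F[Y]$ over $F$, a morphism of $K$-algebras $\tau_z : \varprojlim_m \mathcal A/N^m\mathcal A \to (\mathcal A/N\mathcal A)[[T]]$ is called $z$-admissible if $\tau_z(X) \equiv X \pmod T$ and $\tau_z(Y) = z + T$, where $z$ is identified with the class of $Y$ in $\mathcal A/N\mathcal A$. It extends to $\mathrm{TS}_z : \mathrm{Frac}(\mathcal A) \to (\mathcal A/N\mathcal A)((T))$, $g/D \mapsto \tau_z(D)^{-1}\tau_z(g)$. The order $\mathrm{ord}_z(f)$ is the $T$-adic valuation of $\mathrm{TS}_z(f)$, and $f$ has at most a simple pole at $z$ if $\mathrm{ord}_z(f)\geq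 -1$. For $0\le j<r$, define the $j$-th partial skew residues of $f$ as follows. * For $z\in F^{\mathrm s}$, $z \neq 0$: $\mathrm{sres}_{z,j}(f) = \iota_z(\mathrm{sec}_j(s))\in K\otimes_F F^{\mathrm s}$, where $s \in \mathcal A/N\mathcal A$ is the coefficient of $T^{-1}$ in $\mathrm{TS}_z(f)$, $\mathrm{sec}_j:\mathcal A/N\mathcal A\to K[Y^{\pm1}]/(N)$ is induced by $\sum_i a_iX^i\mapsto\sum_i a_{j+ir}Y^i$, and $\iota_z$ maps $aY^i$ to $a\otimes z^i$. * $\mathrm{sres}_{0,j}(f)\in K$ is the coefficient of $X^{j-r}$ in the expansion of $f$ in $K((X;\theta))$. * $\mathrm{sres}_{\infty,j}(f)\in K$ is the opposite of the coefficient of $\tilde X^{r-j}$ in the expansion of $f$ in $K((\tilde X;\theta^{-1}))$, where $\tilde X=X^{-1}$. The last two are viewed in $K\otimes_F F^{\mathrm s}$ through $a\mapsto a\otimes 1$. Then a $z$-admissible morphism exists for every nonzero $z\in F^{\mathrm s}$. Moreover, let $\tau_z$ be any choice of $z$-admissible morphisms for all these $z$. Let $f\in\mathrm{Frac}(\mathcal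 A)$ be such that all its poles lie in $F^{\mathrm s}\cup\{\infty\}$, i.e. $f = g/D$ for some $g\in\mathcal A$ and some nonzero $D\in F[Y]$ that splits into linear factors over $F^{\mathrm s}$ (this is automatic if $F$ is perfect). Assume that $f$ has at most a simple pole at every nonzero $z\in F^{\mathrm s}$. Then for every $j\in\{0,\dots,r-1\}$ only finitely many $\mathrm{sres}_{z,j}(f)$ are nonzero and $$\sum_{z\in F^{\mathrm s}\sqcup\{\infty\}}\mathrm{sres}_{z,j}(f)=0 .$$ -/

import Mathlib

open Polynomial

noncomputable section

namespace SkewResidue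

universe u v

section Basic

variable {K : Type u} [Field K]

/-- The subfield `F` of `K` fixed by `θ`. -/
abbrev FixedField (θ : RingAut K) : Subfield K :=
  RingHom.eqLocusField (θ : K →+* K) (RingHom.id K)

/-- The action of `ℤ` (written multiplicatively) on `K` through the powers of `θ`. -/
abbrev zAction (θ : RingAut K) : MulSemiringAction (Multiplicative ℤ) K :=
  MulSemiringAction.compHom K (zpowersHom (RingAut K) θ)

/-- The ring `𝒜 = K[X^{±1}; θ]` of skew Laurent polynomials: `a X^i * b X^j = a θ^i(b) X^(i+j)`. -/
def SkewLaurent (_θ : RingAut K) : Type u := SkewMonoidAlgebra K (Multiplicative ℤ)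

instance (θ : RingAut K) : Ring (SkewLaurent θ) :=
  letI := zAction θ
  inferInstanceAs (Ring (SkewMonoidAlgebra K (Multiplicative ℤ)))

namespace SkewLaurent

variable (θ : RingAut K)

/-- The monomial `a X^n`. -/
def monomial (n : ℤ) (a : K) : SkewLaurent θ :=
  SkewMonoidAlgebra.single (Multiplicative.ofAdd n) a

variable {θ} in
/-- The coefficient of `X^n`, as a function of `n`. -/
def coeff (f : SkewLaurent θ) : ℤ →₀ K :=
  Finsupp.comapDomain Multiplicative.ofAdd (SkewMonoidAlgebra.coeff f)
    Multiplicative.ofAdd.injective.injOn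

theorem monomial_mul_monomial (i j : ℤ) (a b : K) :
    monomial θ i a * monomial θ j b = monomial θ (i + j) (a * (θ ^ i) b) := by
  let _ := zAction θ
  exact SkewMonoidAlgebra.single_mul_single

theorem coeff_monomial (n : ℤ) (a : K) : coeff (monomial θ n a) = Finsupp.single n a := by
  classical
  ext m
  simp [coeff, monomial, Finsupp.single_apply]

theorem coeff_add (f g : SkewLaurent θ) : coeff (f + g) = coeff f + coeff g := by
  ext m
  exact DFunLike.congr_fun (SkewMonoidAlgebra.coeff_add f g) _

theorem coeff_zero : coeff (0 : SkewLaurent θ) = 0 := by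
  ext m; rfl

variable {θ} in
theorem ext_coeff {f g : SkewLaurent θ} (h : ∀ n, coeff f n = coeff g n) : f = g :=
  SkewMonoidAlgebra.ext fun a => h a.toAdd

variable {θ} in
@[elab_as_elim]
theorem induction_on {p : SkewLaurent θ → Prop} (f : SkewLaurent θ) (h0 : p 0)
    (hm : ∀ n a, p (monomial θ n a)) (ha : ∀ f g, p f → p g → p (f + g)) : p f :=
  SkewMonoidAlgebra.induction_on f h0 (fun g a => hm g.toAdd a) ha

theorem monomial_add (n : ℤ) (a b : K) :
    monomial θ n (a + b) = monomial θ n a + monomial θ n b :=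
  SkewMonoidAlgebra.single_add _ _ _

theorem one_def : (1 : SkewLaurent θ) = monomial θ 0 1 := rfl

/-- The inclusion `K → 𝒜`. -/
def C : K →+* SkewLaurent θ where
  toFun := monomial θ 0
  map_one' := rfl
  map_zero' := SkewMonoidAlgebra.single_zero _
  map_add' := monomial_add θ 0
  map_mul' a b := by simp [monomial_mul_monomial]

/-- The variable `X`. -/
def X : SkewLaurent θ := monomial θ 1 1

/-- The central element `Y = X ^ r`, where `r` is the order of `θ`. -/
def Y : SkewLaurent θ := X θ ^ orderOf θ

theorem X_pow (n : ℕ) : X θ ^ n = monomial θ n 1 := by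
  induction n with
  | zero => rfl
  | succ n ih => rw [pow_succ, ih]; simp [X, monomial_mul_monomial]

theorem Y_eq : Y θ = monomial θ (orderOf θ) 1 := X_pow θ _

theorem fixed_zpow (c : FixedField θ) (n : ℤ) : (θ ^ n) (c : K) = c := by
  have h : θ ∈ MulAction.stabilizer (RingAut K) (c : K) := c.2
  exact (MulAction.stabilizer (RingAut K) (c : K)).zpow_mem h n

theorem C_fixed_comm (c : FixedField θ) (f : SkewLaurent θ) : Commute (C θ c) f := by
  induction f using induction_on with
  | h0 => exact Commute.zero_right _
  | hm n a =>
    change monomial θ 0 (c : K) * monomial θ n a = monomial θ n a * monomial θ 0 (c : K)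
    simp [monomial_mul_monomial, fixed_zpow, mul_comm]
  | ha f g hf hg => exact hf.add_right hg

theorem Y_comm (f : SkewLaurent θ) : Commute (Y θ) f := by
  induction f using induction_on with
  | h0 => exact Commute.zero_right _
  | hm n a =>
    rw [Y_eq]
    change monomial θ _ _ * monomial θ n a = monomial θ n a * monomial θ _ _
    simp [monomial_mul_monomial, add_comm]
  | ha f g hf hg => exact hf.add_right hg

/-- The inclusion `𝒵⁺ = F[Y] → 𝒜`, mapping the variable to `Y = X ^ r`. -/
def ofCentral : (FixedField θ)[X] →+* SkewLaurent θ :=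
  Polynomial.eval₂RingHom' ((C θ).comp (FixedField θ).subtype) (Y θ)
    fun c => C_fixed_comm θ c _

theorem ofCentral_X : ofCentral θ Polynomial.X = Y θ :=
  Polynomial.eval₂_X _ _

theorem ofCentral_C (c : FixedField θ) : ofCentral θ (Polynomial.C c) = C θ c :=
  Polynomial.eval₂_C _ _

theorem ofCentral_comm (D : (FixedField θ)[X]) (f : SkewLaurent θ) :
    Commute (ofCentral θ D) f := by
  induction D using Polynomial.induction_on' with
  | add p q hp hq => rw [map_add]; exact hp.add_left hq
  | monomial n c =>
    rw [← Polynomial.C_mul_X_pow_eq_monomial, map_mul, map_pow, ofCentral_X, ofCentral_C]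
    exact (C_fixed_comm θ c f).mul_left ((Y_comm θ f).pow_left n)

instance : Algebra (FixedField θ)[X] (SkewLaurent θ) :=
  (ofCentral θ).toAlgebra' fun D f => ofCentral_comm θ D f

theorem algebraMap_def : algebraMap (FixedField θ)[X] (SkewLaurent θ) = ofCentral θ := rfl

theorem Y_pow (n : ℕ) : Y θ ^ n = monomial θ (orderOf θ * n : ℕ) 1 := by
  rw [Y, ← pow_mul, X_pow]

theorem ofCentral_monomial (n : ℕ) (c : FixedField θ) :
    ofCentral θ (Polynomial.monomial n c) = monomial θ (orderOf θ * n : ℕ) c := by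
  rw [← Polynomial.C_mul_X_pow_eq_monomial, map_mul, map_pow, ofCentral_X, ofCentral_C, Y_pow]
  change monomial θ 0 _ * _ = _
  simp [monomial_mul_monomial]

end SkewLaurent

/-- The field `Frac(𝒜) = Frac(𝒵) ⊗ 𝒜` of skew rational functions: fractions `g / D` with
`g ∈ 𝒜` and `D` a nonzero element of `𝒵⁺ = F[Y]`. -/
abbrev SkewFrac (θ : RingAut K) : Type u :=
  LocalizedModule (nonZeroDivisors (FixedField θ)[X]) (SkewLaurent θ)

theorem units_fraction_eq {B : Type*} [Ring B] {x y : B} (hx : IsUnit x) (hy : IsUnit y)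
    (hxy : Commute x y) {a b : B} (h : y * a = x * b) :
    (↑hx.unit⁻¹ : B) * a = (↑hy.unit⁻¹ : B) * b := by
  have hpq : Commute hx.unit hy.unit := Units.ext hxy
  rw [Units.inv_mul_eq_iff_eq_mul,
    ← mul_assoc, ← Units.val_mul, hpq.inv_right.eq, Units.val_mul, mul_assoc,
    IsUnit.unit_spec, ← h, ← mul_assoc, IsUnit.val_inv_mul, one_mul]

/-- The extension of a ring homomorphism `φ : 𝒜 → B` to `Frac(𝒜)`, `g / D ↦ φ(D)⁻¹ φ(g)`,
when `φ` maps the nonzero elements of `𝒵⁺` to units. -/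
def fracLift {θ : RingAut K} {B : Type*} [Ring B] (φ : SkewLaurent θ →+* B)
    (hφ : ∀ D : (FixedField θ)[X], D ≠ 0 → IsUnit (φ (SkewLaurent.ofCentral θ D)))
    (f : SkewFrac θ) : B :=
  LocalizedModule.liftOn f
    (fun p => (↑(hφ p.2 (nonZeroDivisors.coe_ne_zero p.2)).unit⁻¹ : B) * φ p.1) (by
      rintro ⟨a, s⟩ ⟨b, t⟩ ⟨w, h⟩
      have hw := hφ w (nonZeroDivisors.coe_ne_zero w)
      simp only [Submonoid.smul_def, Algebra.smul_def, SkewLaurent.algebraMap_def] at h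
      have h2 := congrArg φ h
      simp only [map_mul] at h2
      exact units_fraction_eq _ _ ((SkewLaurent.ofCentral_comm θ s _).map φ)
        (hw.mul_left_cancel h2))

theorem fracLift_mk {θ : RingAut K} {B : Type*} [Ring B] (φ : SkewLaurent θ →+* B)
    (hφ : ∀ D : (FixedField θ)[X], D ≠ 0 → IsUnit (φ (SkewLaurent.ofCentral θ D)))
    (g : SkewLaurent θ) (D : nonZeroDivisors (FixedField θ)[X]) :
    fracLift φ hφ (LocalizedModule.mk g D) =
      (↑(hφ D (nonZeroDivisors.coe_ne_zero D)).unit⁻¹ : B) * φ g :=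
  rfl

/-- The ring `K((X; θ))` of skew Laurent series `∑ a_i X^i`, with the same multiplication rule
`a X^i * b X^j = a θ^i(b) X^(i+j)` as in `𝒜`. -/
def SkewSeries (_θ : RingAut K) : Type u := HahnSeries ℤ K

namespace SkewSeries

variable (θ : RingAut K)

instance : AddCommGroup (SkewSeries θ) := inferInstanceAs (AddCommGroup (HahnSeries ℤ K))

variable {θ} in
/-- The coefficient of `X^n`. -/
def coeff (f : SkewSeries θ) (n : ℤ) : K := HahnSeries.coeff f n

/-- The monomial `a X^n`. -/
def monomial (n : ℤ) (a : K) : SkewSeries θ := HahnSeries.single n a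

variable {θ} in
/-- The underlying Hahn series of a skew Laurent series. -/
def toHahn (f : SkewSeries θ) : HahnSeries ℤ K := f

/-- The skew Laurent series with a given underlying Hahn series. -/
def ofHahn (f : HahnSeries ℤ K) : SkewSeries θ := f

variable {θ} in
theorem isPWO (f : SkewSeries θ) : (Function.support f.coeff).IsPWO := HahnSeries.isPWO_support' f

variable {θ} in
theorem ext_coeff {f g : SkewSeries θ} (h : ∀ n, f.coeff n = g.coeff n) : f = g :=
  HahnSeries.ext (funext h)

instance : Mul (SkewSeries θ) where
  mul f g :=
    { coeff := fun n => ∑ ij ∈ Finset.antidiagonal f.isPWO g.isPWO n,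
        f.coeff ij.1 * (θ ^ ij.1) (g.coeff ij.2)
      isPWO_support' := by
        refine (f.isPWO.add g.isPWO).mono fun n hn => ?_
        obtain ⟨ij, hij, -⟩ := Finset.exists_ne_zero_of_sum_ne_zero hn
        rw [Finset.mem_antidiagonal] at hij
        exact ⟨_, hij.1, _, hij.2.1, hij.2.2⟩ }

instance : One (SkewSeries θ) := ⟨monomial θ 0 1⟩

theorem coeff_mul (f g : SkewSeries θ) (n : ℤ) :
    (f * g).coeff n = ∑ ij ∈ Finset.antidiagonal f.isPWO g.isPWO n,
      f.coeff ij.1 * (θ ^ ij.1) (g.coeff ij.2) := rfl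

/-- The embedding `∑ a_i X^i ↦ ∑ (a_i X^i) T^i` of `K((X; θ))` into `𝒜((T))`, used only to
transport the ring axioms. -/
def toLaurent (f : SkewSeries θ) : HahnSeries ℤ (SkewLaurent θ) where
  coeff n := SkewLaurent.monomial θ n (f.coeff n)
  isPWO_support' := f.isPWO.mono fun n hn h0 => hn (by
    simp only [h0]; exact SkewMonoidAlgebra.single_zero _)

theorem monomial_inj {n : ℤ} {a b : K}
    (h : SkewLaurent.monomial θ n a = SkewLaurent.monomial θ n b) : a = b :=
  SkewMonoidAlgebra.single_injective _ h

theorem monomial_eq_zero {n : ℤ} {a : K} : SkewLaurent.monomial θ n a = 0 ↔ a = 0 :=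
  SkewMonoidAlgebra.single_eq_zero

theorem toLaurent_injective : Function.Injective (toLaurent θ) := fun _ _ h =>
  ext_coeff fun n => monomial_inj θ (congrFun (congrArg HahnSeries.coeff h) n)

theorem monomial_sum {ι : Type*} (s : Finset ι) (n : ℤ) (a : ι → K) :
    SkewLaurent.monomial θ n (∑ i ∈ s, a i) = ∑ i ∈ s, SkewLaurent.monomial θ n (a i) :=
  map_sum (AddMonoidHom.mk' (SkewLaurent.monomial θ n) (SkewLaurent.monomial_add θ n)) a s

theorem toLaurent_mul (f g : SkewSeries θ) :
    toLaurent θ (f * g) = toLaurent θ f * toLaurent θ g := by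
  have hs : ∀ f : SkewSeries θ, (toLaurent θ f).support = Function.support f.coeff := fun f => by
    ext n
    exact not_congr (monomial_eq_zero θ)
  ext n
  rw [HahnSeries.coeff_mul]
  change SkewLaurent.monomial θ n ((f * g).coeff n) = _
  rw [coeff_mul, monomial_sum]
  refine Finset.sum_congr ?_ fun ij hij => ?_
  · ext ij
    simp [Finset.mem_antidiagonal, hs]
  · rw [Finset.mem_antidiagonal] at hij
    change _ = SkewLaurent.monomial θ _ _ * SkewLaurent.monomial θ _ _
    rw [SkewLaurent.monomial_mul_monomial, hij.2.2]

theorem toLaurent_add (f g : SkewSeries θ) :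
    toLaurent θ (f + g) = toLaurent θ f + toLaurent θ g := by
  ext n
  exact SkewLaurent.monomial_add θ n _ _

theorem toLaurent_zero : toLaurent θ 0 = 0 := by
  ext n
  exact SkewMonoidAlgebra.single_zero _

theorem toLaurent_one : toLaurent θ 1 = 1 := by
  ext n
  change SkewLaurent.monomial θ n ((HahnSeries.single (0 : ℤ) (1 : K)).coeff n) = _
  rw [HahnSeries.coeff_one, HahnSeries.coeff_single]
  split_ifs with h
  · rw [h]; rfl
  · exact SkewMonoidAlgebra.single_zero _

instance : Ring (SkewSeries θ) where
  __ := (inferInstance : AddCommGroup (SkewSeries θ))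
  __ := (inferInstance : Mul (SkewSeries θ))
  __ := (inferInstance : One (SkewSeries θ))
  mul_assoc a b c := toLaurent_injective θ (by simp only [toLaurent_mul, mul_assoc])
  one_mul a := toLaurent_injective θ (by simp only [toLaurent_mul, toLaurent_one, one_mul])
  mul_one a := toLaurent_injective θ (by simp only [toLaurent_mul, toLaurent_one, mul_one])
  left_distrib a b c := toLaurent_injective θ (by
    simp only [toLaurent_mul, toLaurent_add, mul_add])
  right_distrib a b c := toLaurent_injective θ (by
    simp only [toLaurent_mul, toLaurent_add, add_mul])
  zero_mul a := toLaurent_injective θ (by simp only [toLaurent_mul, toLaurent_zero, zero_mul])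
  mul_zero a := toLaurent_injective θ (by simp only [toLaurent_mul, toLaurent_zero, mul_zero])

theorem monomial_mul_monomial (i j : ℤ) (a b : K) :
    monomial θ i a * monomial θ j b = monomial θ (i + j) (a * (θ ^ i) b) := by
  have hm : ∀ i a, toLaurent θ (monomial θ i a) =
      HahnSeries.single i (SkewLaurent.monomial θ i a) := fun i a => by
    ext n
    change SkewLaurent.monomial θ n ((HahnSeries.single i a).coeff n) = _
    rw [HahnSeries.coeff_single, HahnSeries.coeff_single]
    split_ifs with h
    · rw [h]
    · exact SkewMonoidAlgebra.single_zero _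
  apply toLaurent_injective θ
  rw [toLaurent_mul, hm, hm, hm, HahnSeries.single_mul_single, SkewLaurent.monomial_mul_monomial]

/-- The inclusion `K → K((X; θ))`. -/
def C : K →+* SkewSeries θ where
  toFun := monomial θ 0
  map_one' := rfl
  map_zero' := HahnSeries.single_eq_zero
  map_add' := HahnSeries.single_add 0
  map_mul' a b := by simp [monomial_mul_monomial]

/-- The invertible element `X ^ n` of `K((X; θ))`. -/
def Xpow : Multiplicative ℤ →* SkewSeries θ where
  toFun n := monomial θ n.toAdd 1
  map_one' := rfl
  map_mul' m n := by simp [monomial_mul_monomial]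

end SkewSeries

/-- The morphism of `K`-algebras `𝒜 = K[X^{±1}; θ] → K((X; θ))` mapping `X` to `X`. -/
def expandZero (θ : RingAut K) : SkewLaurent θ →+* SkewSeries θ :=
  letI := zAction θ
  SkewMonoidAlgebra.liftNCRingHom (SkewSeries.C θ) (SkewSeries.Xpow θ) (by
    intro x y
    change SkewSeries.monomial θ 0 ((θ ^ y.toAdd) x) * SkewSeries.monomial θ y.toAdd 1 =
      SkewSeries.monomial θ y.toAdd 1 * SkewSeries.monomial θ 0 x
    simp [SkewSeries.monomial_mul_monomial])

/-- The morphism of `K`-algebras `𝒜 = K[X^{±1}; θ] → K((X̃; θ⁻¹))` mapping `X` to `X̃⁻¹`. -/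
def expandInfty (θ : RingAut K) : SkewLaurent θ →+* SkewSeries θ⁻¹ :=
  letI := zAction θ
  SkewMonoidAlgebra.liftNCRingHom (SkewSeries.C θ⁻¹)
    ((SkewSeries.Xpow θ⁻¹).comp (zpowersHom (Multiplicative ℤ) (Multiplicative.ofAdd (-1)))) (by
    intro x y
    change SkewSeries.monomial θ⁻¹ 0 ((θ ^ y.toAdd) x) * SkewSeries.monomial θ⁻¹ _ 1 =
      SkewSeries.monomial θ⁻¹ _ 1 * SkewSeries.monomial θ⁻¹ 0 x
    simp [SkewSeries.monomial_mul_monomial])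

theorem expandZero_monomial (θ : RingAut K) (n : ℤ) (a : K) :
    expandZero θ (SkewLaurent.monomial θ n a) = SkewSeries.monomial θ n a := by
  let _ := zAction θ
  refine (SkewMonoidAlgebra.liftNC_single _ _ _ _).trans ?_
  change SkewSeries.monomial θ 0 a * SkewSeries.monomial θ n 1 = _
  simp [SkewSeries.monomial_mul_monomial]

theorem expandInfty_monomial (θ : RingAut K) (n : ℤ) (a : K) :
    expandInfty θ (SkewLaurent.monomial θ n a) = SkewSeries.monomial θ⁻¹ (-n) a := by
  let _ := zAction θ
  refine (SkewMonoidAlgebra.liftNC_single _ _ _ _).trans ?_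
  change SkewSeries.monomial θ⁻¹ 0 a * SkewSeries.monomial θ⁻¹ _ 1 = _
  simp [SkewSeries.monomial_mul_monomial]

theorem coeff_expandZero {θ : RingAut K} (f : SkewLaurent θ) (n : ℤ) :
    (expandZero θ f).coeff n = f.coeff n := by
  classical
  induction f using SkewLaurent.induction_on with
  | h0 => rw [map_zero, SkewLaurent.coeff_zero]; rfl
  | hm m a =>
    rw [expandZero_monomial, SkewLaurent.coeff_monomial, Finsupp.single_apply]
    simp only [SkewSeries.coeff, SkewSeries.monomial, HahnSeries.coeff_single]
    split_ifs <;> grind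
  | ha f g hf hg =>
    rw [map_add, SkewLaurent.coeff_add, Finsupp.add_apply, ← hf, ← hg]
    rfl

theorem coeff_expandInfty {θ : RingAut K} (f : SkewLaurent θ) (n : ℤ) :
    (expandInfty θ f).coeff n = f.coeff (-n) := by
  classical
  induction f using SkewLaurent.induction_on with
  | h0 => rw [map_zero, SkewLaurent.coeff_zero]; rfl
  | hm m a =>
    rw [expandInfty_monomial, SkewLaurent.coeff_monomial, Finsupp.single_apply]
    simp only [SkewSeries.coeff, SkewSeries.monomial, HahnSeries.coeff_single]
    split_ifs <;> grind
  | ha f g hf hg =>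
    rw [map_add, SkewLaurent.coeff_add, Finsupp.add_apply, ← hf, ← hg]
    rfl

theorem coeff_ofCentral_mem (θ : RingAut K) (D : (FixedField θ)[X]) (m : ℤ) :
    (SkewLaurent.ofCentral θ D).coeff m ∈ FixedField θ := by
  classical
  induction D using Polynomial.induction_on' with
  | add p q hp hq =>
    rw [map_add, SkewLaurent.coeff_add]
    exact add_mem hp hq
  | monomial n c =>
    rw [SkewLaurent.ofCentral_monomial, SkewLaurent.coeff_monomial, Finsupp.single_apply]
    split_ifs
    exacts [c.2, zero_mem _]

theorem coeff_ofCentral_of_not_dvd (θ : RingAut K) (D : (FixedField θ)[X]) {m : ℤ}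
    (hm : ¬ (orderOf θ : ℤ) ∣ m) : (SkewLaurent.ofCentral θ D).coeff m = 0 := by
  classical
  induction D using Polynomial.induction_on' with
  | add p q hp hq =>
    rw [map_add, SkewLaurent.coeff_add, Finsupp.add_apply, hp, hq, add_zero]
  | monomial n c =>
    rw [SkewLaurent.ofCentral_monomial, SkewLaurent.coeff_monomial, Finsupp.single_apply,
      if_neg]
    rintro rfl
    exact hm (by simp)

theorem coeff_ofCentral_mul {θ : RingAut K} (hθ : IsOfFinOrder θ) (D : (FixedField θ)[X]) (n : ℕ) :
    (SkewLaurent.ofCentral θ D).coeff (orderOf θ * n : ℕ) = D.coeff n := by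
  classical
  induction D using Polynomial.induction_on' with
  | add p q hp hq =>
    rw [map_add, SkewLaurent.coeff_add, Finsupp.add_apply, hp, hq]
    simp
  | monomial m c =>
    rw [SkewLaurent.ofCentral_monomial, SkewLaurent.coeff_monomial, Finsupp.single_apply,
      Polynomial.coeff_monomial]
    have h : ((orderOf θ * m : ℕ) : ℤ) = (orderOf θ * n : ℕ) ↔ m = n := by
      rw [Nat.cast_inj]
      exact Nat.mul_right_inj hθ.orderOf_pos.ne'
    simp only [h]
    split_ifs <;> rfl

theorem exists_coeff_ofCentral_ne_zero {θ : RingAut K} (hθ : IsOfFinOrder θ)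
    {D : (FixedField θ)[X]} (hD : D ≠ 0) : ∃ m, (SkewLaurent.ofCentral θ D).coeff m ≠ 0 := by
  obtain ⟨n, hn⟩ : ∃ n, D.coeff n ≠ 0 := by
    by_contra! h
    exact hD (Polynomial.ext h)
  refine ⟨(orderOf θ * n : ℕ), ?_⟩
  rw [coeff_ofCentral_mul hθ]
  simpa using hn

theorem SkewSeries.isUnit_of_central {θ : RingAut K} (d : SkewSeries θ) (h0 : ∃ n, d.coeff n ≠ 0)
    (h1 : ∀ i, d.coeff i ≠ 0 → θ ^ i = 1) (h2 : ∀ i j : ℤ, (θ ^ i) (d.coeff j) = d.coeff j) :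
    IsUnit d := by
  have hd : toHahn d ≠ 0 := by
    rintro h
    obtain ⟨n, hn⟩ := h0
    exact hn (congrFun (congrArg HahnSeries.coeff h) n)
  have hde : toHahn d * (toHahn d)⁻¹ = 1 := mul_inv_cancel₀ hd
  have hed : (toHahn d)⁻¹ * toHahn d = 1 := inv_mul_cancel₀ hd
  refine isUnit_iff_exists.2
    ⟨ofHahn θ (toHahn d)⁻¹, ext_coeff fun n => ?_, ext_coeff fun n => ?_⟩
  · refine Eq.trans ?_ (congrFun (congrArg HahnSeries.coeff hde) n)
    rw [coeff_mul, HahnSeries.coeff_mul]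
    refine Finset.sum_congr rfl fun ij hij => ?_
    rw [h1 _ (Finset.mem_antidiagonal.1 hij).1]
    rfl
  · refine Eq.trans ?_ (congrFun (congrArg HahnSeries.coeff hed) n)
    rw [coeff_mul, HahnSeries.coeff_mul]
    refine Finset.sum_congr rfl fun ij hij => ?_
    rw [h2]
    rfl

theorem isUnit_expandZero {θ : RingAut K} (hθ : IsOfFinOrder θ) (D : (FixedField θ)[X])
    (hD : D ≠ 0) : IsUnit (expandZero θ (SkewLaurent.ofCentral θ D)) := by
  apply SkewSeries.isUnit_of_central
  · simpa only [coeff_expandZero] using exists_coeff_ofCentral_ne_zero hθ hD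
  · intro i hi
    rw [coeff_expandZero] at hi
    refine orderOf_dvd_iff_zpow_eq_one.1 ?_
    by_contra h
    exact hi (coeff_ofCentral_of_not_dvd θ D h)
  · intro i j
    rw [coeff_expandZero]
    exact SkewLaurent.fixed_zpow θ ⟨_, coeff_ofCentral_mem θ D j⟩ i

theorem isUnit_expandInfty {θ : RingAut K} (hθ : IsOfFinOrder θ) (D : (FixedField θ)[X])
    (hD : D ≠ 0) : IsUnit (expandInfty θ (SkewLaurent.ofCentral θ D)) := by
  apply SkewSeries.isUnit_of_central
  · obtain ⟨m, hm⟩ := exists_coeff_ofCentral_ne_zero hθ hD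
    exact ⟨-m, by rwa [coeff_expandInfty, neg_neg]⟩
  · intro i hi
    rw [coeff_expandInfty] at hi
    rw [inv_zpow']
    refine orderOf_dvd_iff_zpow_eq_one.1 ?_
    by_contra h
    exact hi (coeff_ofCentral_of_not_dvd θ D h)
  · intro i j
    rw [coeff_expandInfty, inv_zpow']
    exact SkewLaurent.fixed_zpow θ ⟨_, coeff_ofCentral_mem θ D _⟩ _

/-- The Taylor expansion map `TS_0 : Frac(𝒜) → K((X; θ))`. -/
def taylorZero {θ : RingAut K} (hθ : IsOfFinOrder θ) : SkewFrac θ → SkewSeries θ :=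
  fracLift (expandZero θ) (isUnit_expandZero hθ)

/-- The Taylor expansion map `TS_∞ : Frac(𝒜) → K((X̃; θ⁻¹))`, where `X̃ = X⁻¹`. -/
def taylorInfty {θ : RingAut K} (hθ : IsOfFinOrder θ) : SkewFrac θ → SkewSeries θ⁻¹ :=
  fracLift (expandInfty θ) (isUnit_expandInfty hθ)

section Quotient

variable (θ : RingAut K)

/-- The ideal `N𝒜` of `𝒜`, for `N ∈ 𝒵⁺`. -/
abbrev centralIdeal (N : (FixedField θ)[X]) : Ideal (SkewLaurent θ) :=
  Ideal.span {SkewLaurent.ofCentral θ N}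

instance (N : (FixedField θ)[X]) : (centralIdeal θ N).IsTwoSided where
  mul_mem_of_left {a} b ha := by
    obtain ⟨c, rfl⟩ := Ideal.mem_span_singleton'.1 ha
    refine Ideal.mem_span_singleton'.2 ⟨c * b, ?_⟩
    rw [mul_assoc, mul_assoc, (SkewLaurent.ofCentral_comm θ N b).eq]

/-- The quotient ring `𝒜 / N𝒜`. -/
abbrev SkewQuot (N : (FixedField θ)[X]) : Type u := SkewLaurent θ ⧸ centralIdeal θ N

theorem centralIdeal_pow_le (N : (FixedField θ)[X]) {m n : ℕ} (h : m ≤ n) :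
    centralIdeal θ (N ^ n) ≤ centralIdeal θ (N ^ m) := by
  rw [Ideal.span_singleton_le_iff_mem, Ideal.mem_span_singleton']
  refine ⟨SkewLaurent.ofCentral θ (N ^ (n - m)), ?_⟩
  rw [← map_mul, ← pow_add, Nat.sub_add_cancel h]

/-- The completion `lim 𝒜 / N^m 𝒜`, as the ring of compatible families. -/
def completion (N : (FixedField θ)[X]) : Subring (∀ m : ℕ, SkewQuot θ (N ^ m)) where
  carrier := {f | ∀ m n (h : m ≤ n), Ideal.Quotient.factor (centralIdeal_pow_le θ N h) (f n) = f m}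
  mul_mem' hf hg m n h := by rw [Pi.mul_apply, map_mul, hf m n h, hg m n h]; rfl
  one_mem' m n h := map_one _
  add_mem' hf hg m n h := by rw [Pi.add_apply, map_add, hf m n h, hg m n h]; rfl
  zero_mem' m n h := map_zero _
  neg_mem' hf m n h := by rw [Pi.neg_apply, map_neg, hf m n h]; rfl

/-- The natural map `𝒜 → lim 𝒜 / N^m 𝒜`. -/
def toCompletion (N : (FixedField θ)[X]) : SkewLaurent θ →+* completion θ N :=
  RingHom.codRestrict (RingHom.pi fun m => Ideal.Quotient.mk (centralIdeal θ (N ^ m)))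
    (completion θ N) fun _ _ _ _ => rfl

end Quotient

section Admissible

variable (θ : RingAut K) {Fs : Type v} [Field Fs] [Algebra (FixedField θ) Fs]

/-- A `z`-admissible morphism: a morphism of `K`-algebras `τ : lim 𝒜 / N^m 𝒜 → (𝒜 / N𝒜)[[T]]`,
where `N` is the minimal polynomial of `z` over `F`, such that `τ(X) ≡ X (mod T)` and
`τ(Y) = z + T`. Here `z` is seen in `𝒜 / N𝒜` as the class of `Y`. -/
structure Admissible (z : Fs) where
  /-- The underlying ring homomorphism. -/
  toRingHom : completion θ (minpoly (FixedField θ) z) →+*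
    PowerSeries (SkewQuot θ (minpoly (FixedField θ) z))
  map_C : ∀ a : K, toRingHom (toCompletion θ _ (SkewLaurent.C θ a)) =
    PowerSeries.C (Ideal.Quotient.mk _ (SkewLaurent.C θ a))
  map_X : PowerSeries.constantCoeff (toRingHom (toCompletion θ _ (SkewLaurent.X θ))) =
    Ideal.Quotient.mk _ (SkewLaurent.X θ)
  map_Y : toRingHom (toCompletion θ _ (SkewLaurent.Y θ)) =
    PowerSeries.C (Ideal.Quotient.mk _ (SkewLaurent.Y θ)) + PowerSeries.X

namespace Admissible

variable {θ} {z : Fs} (τ : Admissible θ z)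

/-- The composite `𝒜 → lim 𝒜 / N^m 𝒜 → (𝒜 / N𝒜)[[T]] → (𝒜 / N𝒜)((T))`. -/
def expand : SkewLaurent θ →+* LaurentSeries (SkewQuot θ (minpoly (FixedField θ) z)) :=
  (HahnSeries.ofPowerSeries ℤ _).comp (τ.toRingHom.comp (toCompletion θ _))

theorem isUnit_expand (hz : IsIntegral (FixedField θ) z) (D : (FixedField θ)[X]) (hD : D ≠ 0) :
    IsUnit (τ.expand (SkewLaurent.ofCentral θ D)) := by
  have : Fact (Irreducible (minpoly (FixedField θ) z)) := ⟨minpoly.irreducible hz⟩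
  let L := AdjoinRoot (minpoly (FixedField θ) z)
  let ψ : L →+* SkewQuot θ (minpoly (FixedField θ) z) :=
    Ideal.Quotient.lift (Ideal.span {minpoly (FixedField θ) z})
      ((Ideal.Quotient.mk _).comp (SkewLaurent.ofCentral θ)) (by
        intro a ha
        obtain ⟨c, rfl⟩ := Ideal.mem_span_singleton'.1 ha
        rw [RingHom.comp_apply, map_mul, Ideal.Quotient.eq_zero_iff_mem]
        exact Ideal.mul_mem_left _ _ (Ideal.mem_span_singleton_self _))
  let t : (FixedField θ)[X] →+* PowerSeries L :=
    Polynomial.coeToPowerSeries.ringHom.comp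
      ((Polynomial.taylorAlgHom (AdjoinRoot.root (minpoly (FixedField θ) z))).toRingHom.comp
        (Polynomial.mapRingHom (AdjoinRoot.of (minpoly (FixedField θ) z))))
  have key : (τ.toRingHom.comp (toCompletion θ _)).comp (SkewLaurent.ofCentral θ) =
      (PowerSeries.map ψ).comp t := by
    refine Polynomial.ringHom_ext (fun a => ?_) ?_
    · have h1 : ψ (AdjoinRoot.of (minpoly (FixedField θ) z) a) =
          Ideal.Quotient.mk _ (SkewLaurent.ofCentral θ (Polynomial.C a)) := rfl
      simp only [RingHom.comp_apply, SkewLaurent.ofCentral_C, τ.map_C]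
      simp [t, h1, SkewLaurent.ofCentral_C]
    · have h1 : ψ (AdjoinRoot.root (minpoly (FixedField θ) z)) =
          Ideal.Quotient.mk _ (SkewLaurent.ofCentral θ Polynomial.X) := rfl
      simp only [RingHom.comp_apply, SkewLaurent.ofCentral_X, τ.map_Y]
      simp [t, h1, SkewLaurent.ofCentral_X, add_comm]
  have ht : t D ≠ 0 := by
    intro h
    have h2 : Polynomial.taylor (AdjoinRoot.root (minpoly (FixedField θ) z))
        (D.map (AdjoinRoot.of (minpoly (FixedField θ) z))) = 0 :=
      Polynomial.coe_injective _ (h.trans Polynomial.coe_zero.symm)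
    rw [Polynomial.taylor_eq_zero, Polynomial.map_eq_zero] at h2
    exact hD h2
  have hexp : τ.expand (SkewLaurent.ofCentral θ D) =
      HahnSeries.ofPowerSeries ℤ _ (PowerSeries.map ψ (t D)) :=
    congrArg (HahnSeries.ofPowerSeries ℤ _) (RingHom.congr_fun key D)
  rw [hexp, ← PowerSeries.X_pow_order_mul_divXPowOrder (f := t D), map_mul, map_mul, map_pow,
    PowerSeries.map_X, HahnSeries.ofPowerSeries_X_pow]
  refine IsUnit.mul ?_ ?_
  · refine isUnit_iff_exists.2 ⟨HahnSeries.single (-((t D).order.toNat : ℤ)) 1, ?_, ?_⟩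
    · simp [HahnSeries.single_mul_single]
    · simp [HahnSeries.single_mul_single]
  · exact ((PowerSeries.isUnit_divided_by_X_pow_order ht).map _).map _

theorem isIntegral_of_isSepClosure [IsSepClosure (FixedField θ) Fs] (z : Fs) :
    IsIntegral (FixedField θ) z :=
  have : Algebra.IsSeparable (FixedField θ) Fs := IsSepClosure.separable
  Algebra.IsIntegral.isIntegral z

/-- The Taylor expansion map `TS_z : Frac(𝒜) → (𝒜 / N𝒜)((T))` attached to a `z`-admissible
morphism. -/
def taylor [IsSepClosure (FixedField θ) Fs] :
    SkewFrac θ → LaurentSeries (SkewQuot θ (minpoly (FixedField θ) z)) :=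
  fracLift τ.expand (τ.isUnit_expand (isIntegral_of_isSepClosure z))

/-- The order of vanishing `ord_z(f)`: the `T`-adic valuation of `TS_z(f)`. -/
def ord [IsSepClosure (FixedField θ) Fs] (f : SkewFrac θ) : WithTop ℤ :=
  (τ.taylor f).orderTop

/-- The skew residue `sres_z(f)`: the coefficient of `T⁻¹` in `TS_z(f)`. -/
def sres [IsSepClosure (FixedField θ) Fs] (f : SkewFrac θ) :
    SkewQuot θ (minpoly (FixedField θ) z) :=
  (τ.taylor f).coeff (-1)

end Admissible

end Admissible

section Sections

/-- The section operator `sec_j : 𝒜 → 𝒞 = K[Y^{±1}]`, `∑ a_i X^i ↦ ∑ a_{j+ir} Y^i`. -/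
def sec {θ : RingAut K} (hθ : IsOfFinOrder θ) (j : ℤ) : SkewLaurent θ →+ LaurentPolynomial K where
  toFun f := AddMonoidAlgebra.ofCoeff
    (Finsupp.comapDomain (fun i : ℤ => j + i * (orderOf θ : ℤ)) f.coeff (by
      intro a _ b _ h
      have := hθ.orderOf_pos
      simpa [this.ne'] using h))
  map_zero' := by ext i; rfl
  map_add' f g := by
    ext i
    exact DFunLike.congr_fun (SkewLaurent.coeff_add θ f g) _

theorem coeff_sec {θ : RingAut K} (hθ : IsOfFinOrder θ) (j : ℤ) (f : SkewLaurent θ) (i : ℤ) :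
    (sec hθ j f).coeff i = f.coeff (j + i * orderOf θ) := rfl

/-- The inclusion `𝒵⁺ = F[Y] → 𝒞 = K[Y^{±1}]`. -/
def centralToLaurent (θ : RingAut K) : (FixedField θ)[X] →+* LaurentPolynomial K :=
  Polynomial.toLaurent.comp (Polynomial.mapRingHom (FixedField θ).subtype)

/-- The quotient `𝒞 / N𝒞`, for `N ∈ 𝒵⁺`. -/
abbrev CommQuot (θ : RingAut K) (N : (FixedField θ)[X]) : Type u :=
  LaurentPolynomial K ⧸ Ideal.span {centralToLaurent θ N}

theorem sec_ofCentral_mul {θ : RingAut K} (hθ : IsOfFinOrder θ) (j : ℤ) (D : (FixedField θ)[X])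
    (f : SkewLaurent θ) :
    sec hθ j (SkewLaurent.ofCentral θ D * f) = centralToLaurent θ D * sec hθ j f := by
  classical
  induction D using Polynomial.induction_on' with
  | add p q hp hq => simp only [map_add, add_mul, hp, hq]
  | monomial m c =>
    induction f using SkewLaurent.induction_on with
    | h0 => simp
    | ha f g hf hg => simp only [map_add, mul_add, hf, hg]
    | hm n a =>
      ext i
      rw [SkewLaurent.ofCentral_monomial, SkewLaurent.monomial_mul_monomial, coeff_sec,
        SkewLaurent.coeff_monomial, centralToLaurent, RingHom.comp_apply,
        Polynomial.coe_mapRingHom, Polynomial.map_monomial, ← Polynomial.C_mul_X_pow_eq_monomial,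
        map_mul, map_pow, Polynomial.toLaurent_C, Polynomial.toLaurent_X, LaurentPolynomial.T_pow,
        ← LaurentPolynomial.single_eq_C_mul_T, AddMonoidAlgebra.coeff_single_mul_apply, coeff_sec,
        SkewLaurent.coeff_monomial, Finsupp.single_apply, Finsupp.single_apply]
      have h1 : θ ^ ((orderOf θ * m : ℕ) : ℤ) = 1 := by
        rw [zpow_natCast, pow_mul, pow_orderOf_eq_one, one_pow]
      rw [h1]
      have h2 : ((orderOf θ * m : ℕ) : ℤ) + n = j + i * orderOf θ ↔
          n = j + (-((m : ℤ) * 1) + i) * orderOf θ := by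
        push_cast
        constructor <;> intro h <;> linarith
      simp only [h2]
      split_ifs
      · rfl
      · simp

/-- The map `𝒜 / N𝒜 → 𝒞 / N𝒞` induced by the section operator `sec_j`. -/
def secQuot {θ : RingAut K} (hθ : IsOfFinOrder θ) (j : ℤ) (N : (FixedField θ)[X]) :
    SkewQuot θ N →+ CommQuot θ N :=
  QuotientAddGroup.lift (centralIdeal θ N).toAddSubgroup
    ((Ideal.Quotient.mk (Ideal.span {centralToLaurent θ N})).toAddMonoidHom.comp (sec hθ j)) (by
      intro f hf
      obtain ⟨g, rfl⟩ := Ideal.mem_span_singleton'.1 hf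
      rw [← (SkewLaurent.ofCentral_comm θ N g).eq]
      change Ideal.Quotient.mk _ (sec hθ j _) = 0
      rw [sec_ofCentral_mul, Ideal.Quotient.eq_zero_iff_mem]
      exact Ideal.mul_mem_right _ _ (Ideal.mem_span_singleton_self _))

open TensorProduct

variable (θ : RingAut K) {Fs : Type v} [Field Fs] [Algebra (FixedField θ) Fs]

/-- The embedding `ι_z : 𝒞 / N𝒞 → K ⊗_F Fˢ`, `a Y^i ↦ a ⊗ z^i`, where `N` is the minimal
polynomial of `z ≠ 0`. -/
def iota (z : Fs) (hz : z ≠ 0) :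
    CommQuot θ (minpoly (FixedField θ) z) →+* K ⊗[FixedField θ] Fs :=
  Ideal.Quotient.lift _
    (LaurentPolynomial.eval₂ (algebraMap K (K ⊗[FixedField θ] Fs))
      (Units.map (Algebra.TensorProduct.includeRight :
        Fs →ₐ[FixedField θ] K ⊗[FixedField θ] Fs).toRingHom.toMonoidHom (Units.mk0 z hz))) (by
      intro a ha
      obtain ⟨c, rfl⟩ := Ideal.mem_span_singleton'.1 ha
      rw [map_mul]
      refine mul_eq_zero_of_right _ ?_
      rw [centralToLaurent, RingHom.comp_apply, LaurentPolynomial.eval₂_toLaurent,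
        Polynomial.coe_mapRingHom, Polynomial.eval₂_map]
      have h : (algebraMap K (K ⊗[FixedField θ] Fs)).comp (FixedField θ).subtype =
          ((Algebra.TensorProduct.includeRight :
            Fs →ₐ[FixedField θ] K ⊗[FixedField θ] Fs).toRingHom).comp
              (algebraMap (FixedField θ) Fs) := by
        ext a
        exact ((Algebra.TensorProduct.includeRight :
          Fs →ₐ[FixedField θ] K ⊗[FixedField θ] Fs).commutes a).symm
      rw [h]
      have h3 := Polynomial.hom_eval₂ (minpoly (FixedField θ) z) (algebraMap (FixedField θ) Fs)
        ((Algebra.TensorProduct.includeRight :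
            Fs →ₐ[FixedField θ] K ⊗[FixedField θ] Fs).toRingHom) z
      refine h3.symm.trans ?_
      rw [← Polynomial.aeval_def, minpoly.aeval, map_zero])

variable {θ}

/-- The `j`-th partial skew residue of `f` at a nonzero point `z`: `ι_z (sec_j (sres_z f))`. -/
def Admissible.partialRes (hθ : IsOfFinOrder θ) [IsSepClosure (FixedField θ) Fs] {z : Fs}
    (τ : Admissible θ z) (hz : z ≠ 0) (j : ℕ) (f : SkewFrac θ) : K ⊗[FixedField θ] Fs :=
  iota θ z hz (secQuot hθ j _ (τ.sres f))

/-- The `j`-th partial skew residue of `f` at `0`: the coefficient of `X^(j-r)` in `TS_0(f)`. -/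
def partialResZero (hθ : IsOfFinOrder θ) (j : ℕ) (f : SkewFrac θ) : K :=
  (taylorZero hθ f).coeff ((j : ℤ) - orderOf θ)

/-- The `j`-th partial skew residue of `f` at `∞`: the opposite of the coefficient of `X̃^(r-j)`
in `TS_∞(f)`. -/
def partialResInfty (hθ : IsOfFinOrder θ) (j : ℕ) (f : SkewFrac θ) : K :=
  -(taylorInfty hθ f).coeff ((orderOf θ : ℤ) - j)

open Classical in
/-- The `j`-th partial skew residue of `f` at a point of `Fˢ ∪ {∞}`, with respect to a choice `τ`
of admissible morphisms at the nonzero points of `Fˢ`. The residues at `0` and `∞`, which belong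
to `K`, are seen in `K ⊗_F Fˢ`. -/
def partialRes (hθ : IsOfFinOrder θ) [IsSepClosure (FixedField θ) Fs]
    (τ : ∀ z : Fs, z ≠ 0 → Admissible θ z) (j : ℕ) (f : SkewFrac θ) (p : OnePoint Fs) :
    K ⊗[FixedField θ] Fs :=
  p.elim (algebraMap K (K ⊗[FixedField θ] Fs) (partialResInfty hθ j f)) fun z =>
    if hz : z = 0 then algebraMap K (K ⊗[FixedField θ] Fs) (partialResZero hθ j f)
    else (τ z hz).partialRes hθ hz j f

variable (Fs) in
/-- All the poles of `f` are in `Fˢ ∪ {∞}`: `f` can be written `g / D` with `g ∈ 𝒜` and with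
`D ∈ F[Y]` nonzero whose roots all belong to `Fˢ`. -/
def PolesSeparable (f : SkewFrac θ) : Prop :=
  ∃ (g : SkewLaurent θ) (D : nonZeroDivisors (FixedField θ)[X]),
    f = LocalizedModule.mk g D ∧
      ((D : (FixedField θ)[X]).map (algebraMap (FixedField θ) Fs)).Splits

end Sections

end Basic

end SkewResidue

end

/-!
Existence. Dedekind's theorem gives `e ∈ K` of nonzero trace. For `u` in a commutative ring
commuting with `X`, the `r`-th power of `(1 + e u) X` is `P(u) X^r`, where
`P = ∏ (1 + θ^i(e) T) ∈ F[T]` satisfies `P(0) = 1` and `P'(0) = Tr(e) ≠ 0`. By Hensel's lemma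
`P(u) = 1 + T / z` has a solution `u ∈ T F(z)[[T]]`, and `X ↦ (1 + e u) X` then sends `Y` to
`z + T`, whether or not `r` vanishes in `K`.

Residue formula. Write `f = g / D` in lowest terms, so that `D(0) ≠ 0`. At a root `z` of `D`,
comparing the coefficients of `T^0` in `τ(D) TS(f) = τ(g)` gives `D'(z) · sres_z(f) = g mod N`. In
particular `g` would be divisible by `N` if `z` were a double root, so `D` is separable, and the
`j`-th partial residue at `z` is `(sec_j g)(z) / D'(z)`. The sections are linear over the central
`F[Y]`, hence carry the skew expansions of `f` at `0` and `∞` to the Laurent expansions of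
`sec_j(g) / D`. The statement thus becomes the residue formula for the commutative rational
function `sec_j(g) / D`, which decomposes into simple fractions by Lagrange interpolation.
-/

noncomputable section

namespace SkewResidue

section CommutativeResidues

open LaurentPolynomial (T)

variable {R : Type*} [CommRing R]

/-- The expansion `R[T^{±1}] → R((T))` of a Laurent polynomial `h`: that of `h(T)` at `0` for
`ε = 1`, and that of `h(T⁻¹)`, i.e. of `h` at `∞`, for `ε = -1`. -/
def laurentExpansion (ε : ℤˣ) : LaurentPolynomial R →+* HahnSeries ℤ R :=
  LaurentPolynomial.eval₂ HahnSeries.C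
    ⟨HahnSeries.single (ε : ℤ) 1, HahnSeries.single (-ε : ℤ) 1, by simp, by simp⟩

theorem laurentExpansion_C (ε : ℤˣ) (a : R) :
    laurentExpansion ε (LaurentPolynomial.C a) = HahnSeries.C a :=
  LaurentPolynomial.eval₂_C _ _ a

theorem laurentExpansion_single (ε : ℤˣ) (n : ℤ) (a : R) :
    laurentExpansion ε (AddMonoidAlgebra.single n a) = HahnSeries.single (ε * n) a := by
  have hpow (x : (HahnSeries ℤ R)ˣ) (m : ℤ) (hx : (x : HahnSeries ℤ R) = HahnSeries.single m 1)
      (hx' : (↑x⁻¹ : HahnSeries ℤ R) = HahnSeries.single (-m) 1) :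
      ((x ^ n : (HahnSeries ℤ R)ˣ) : HahnSeries ℤ R) = HahnSeries.single (m * n) 1 := by
    obtain ⟨k, rfl | rfl⟩ := n.eq_nat_or_neg
    · simp [hx, mul_comm]
    · rw [zpow_neg, ← inv_zpow, zpow_natCast, Units.val_pow_eq_pow_val, hx']
      simp [mul_comm]
  rw [LaurentPolynomial.single_eq_C_mul_T, laurentExpansion, LaurentPolynomial.eval₂_C_mul_T,
    hpow _ ε rfl rfl, HahnSeries.C_apply, HahnSeries.single_mul_single, zero_add, mul_one]

theorem coeff_laurentExpansion (ε : ℤˣ) (h : LaurentPolynomial R) (n : ℤ) :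
    (laurentExpansion ε h).coeff (ε * n) = h.coeff n := by
  induction h using LaurentPolynomial.induction_on' with
  | add p q hp hq => simp [hp, hq]
  | C_mul_T m a =>
    have hε : (ε : ℤ) * n = ε * m ↔ m = n := by rw [mul_right_inj' ε.ne_zero, eq_comm]
    rw [← LaurentPolynomial.single_eq_C_mul_T, laurentExpansion_single, HahnSeries.coeff_single,
      AddMonoidAlgebra.coeff_single, Finsupp.single_apply]
    simp only [hε]

theorem T_sub_C_dvd_sub_C_eval (u : Rˣ) (h : LaurentPolynomial R) :
    T 1 - LaurentPolynomial.C (u : R) ∣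
      h - LaurentPolynomial.C (LaurentPolynomial.eval₂ (RingHom.id R) u h) := by
  let I := Ideal.span {T 1 - LaurentPolynomial.C (u : R)}
  have hT : Ideal.Quotient.mk I (T 1) = Ideal.Quotient.mk I (LaurentPolynomial.C (u : R)) :=
    Ideal.Quotient.eq.2 (Ideal.mem_span_singleton_self _)
  have hmk : Ideal.Quotient.mk I = (Ideal.Quotient.mk I).comp
      (LaurentPolynomial.C.comp (LaurentPolynomial.eval₂ (RingHom.id R) u)) :=
    IsLocalization.ringHom_ext (Submonoid.powers (X : R[X]))
      (Polynomial.ringHom_ext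
        (by simp [-Ideal.Quotient.mk_comp_algebraMap, LaurentPolynomial.algebraMap_eq_toLaurent])
        (by simpa [-Ideal.Quotient.mk_comp_algebraMap, LaurentPolynomial.algebraMap_eq_toLaurent]
          using hT))
  exact Ideal.mem_span_singleton.1 (Ideal.Quotient.eq.1 (RingHom.congr_fun hmk h))

theorem exists_ofPowerSeries_eq {p q : PowerSeries R} (hp : IsUnit (PowerSeries.constantCoeff p))
    {v : HahnSeries ℤ R} (h : HahnSeries.ofPowerSeries ℤ R p * v = HahnSeries.ofPowerSeries ℤ R q) :
    ∃ s, p * s = q ∧ v = HahnSeries.ofPowerSeries ℤ R s := by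
  obtain ⟨p', hp'⟩ := (PowerSeries.isUnit_iff_constantCoeff.2 hp).exists_right_inv
  refine ⟨p' * q, by rw [← mul_assoc, hp', one_mul], ?_⟩
  rw [map_mul, ← h, ← mul_assoc, ← map_mul, mul_comm p', hp', map_one, one_mul]

theorem coeff_neg_one_eq_zero_of_mul_eq_C (u : Rˣ) {v : HahnSeries ℤ R} {c : R}
    (h : laurentExpansion 1 (T 1 - LaurentPolynomial.C (u : R)) * v = HahnSeries.C c) :
    v.coeff (-1) = 0 := by
  have hT : laurentExpansion 1 (T 1 - LaurentPolynomial.C (u : R)) =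
      HahnSeries.ofPowerSeries ℤ R (PowerSeries.X - PowerSeries.C (u : R)) := by
    rw [map_sub, map_sub, laurentExpansion_C, T, laurentExpansion_single]
    simp
  rw [hT, ← HahnSeries.ofPowerSeries_C] at h
  obtain ⟨s, -, rfl⟩ := exists_ofPowerSeries_eq (by simp) h
  simp [PowerSeries.coeff_coe]

theorem coeff_one_eq_of_mul_eq_C (u : R) {v : HahnSeries ℤ R} {c : R}
    (h : laurentExpansion (-1) (T 1 - LaurentPolynomial.C u) * v = HahnSeries.C c) :
    v.coeff 1 = c := by
  have hT : HahnSeries.single 1 1 * laurentExpansion (-1) (T 1 - LaurentPolynomial.C u) =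
      HahnSeries.ofPowerSeries ℤ R (1 - PowerSeries.X * PowerSeries.C u) := by
    rw [map_sub, laurentExpansion_C, T, laurentExpansion_single]
    simp [mul_sub]
  have h' : HahnSeries.ofPowerSeries ℤ R (1 - PowerSeries.X * PowerSeries.C u) * v =
      HahnSeries.ofPowerSeries ℤ R (PowerSeries.X * PowerSeries.C c) := by
    rw [← hT, mul_assoc, h]
    simp
  obtain ⟨s, hs, rfl⟩ := exists_ofPowerSeries_eq (by simp) h'
  have hs0 : PowerSeries.constantCoeff s = 0 := by
    simpa using congrArg PowerSeries.constantCoeff hs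
  have hs1 : PowerSeries.coeff 1 s = c := by
    simpa [PowerSeries.coeff_one_mul, hs0] using congrArg (PowerSeries.coeff 1) hs
  simpa [PowerSeries.coeff_coe] using hs1

theorem eval_add_coeff_neg_one_sub_coeff_one (u : Rˣ) (h : LaurentPolynomial R)
    {w₀ w₁ : HahnSeries ℤ R}
    (h₀ : laurentExpansion 1 (T 1 - LaurentPolynomial.C (u : R)) * w₀ = laurentExpansion 1 h)
    (h₁ : laurentExpansion (-1) (T 1 - LaurentPolynomial.C (u : R)) * w₁ =
      laurentExpansion (-1) h) :
    LaurentPolynomial.eval₂ (RingHom.id R) u h + w₀.coeff (-1) - w₁.coeff 1 = 0 := by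
  obtain ⟨k, hk⟩ := T_sub_C_dvd_sub_C_eval u h
  set c := LaurentPolynomial.eval₂ (RingHom.id R) u h
  have hremainder {ε : ℤˣ} {w : HahnSeries ℤ R}
      (hw : laurentExpansion ε (T 1 - LaurentPolynomial.C (u : R)) * w = laurentExpansion ε h) :
      laurentExpansion ε (T 1 - LaurentPolynomial.C (u : R)) * (w - laurentExpansion ε k) =
        HahnSeries.C c := by
    rw [mul_sub, hw, ← map_mul, ← hk, ← map_sub, sub_sub_cancel, laurentExpansion_C]
  have hr₀ := coeff_neg_one_eq_zero_of_mul_eq_C u (hremainder h₀)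
  have hr₁ := coeff_one_eq_of_mul_eq_C (u : R) (hremainder h₁)
  have hk₀ : (laurentExpansion 1 k).coeff (-1) = k.coeff (-1) := by
    simpa using coeff_laurentExpansion 1 k (-1)
  have hk₁ : (laurentExpansion (-1) k).coeff 1 = k.coeff (-1) := by
    simpa using coeff_laurentExpansion (-1) k (-1)
  rw [HahnSeries.coeff_sub, hk₀] at hr₀
  rw [HahnSeries.coeff_sub, hk₁] at hr₁
  linear_combination hr₀ - hr₁

theorem exists_mul_add_sum_divByMonic_eq_one {L : Type*} [Field L] [DecidableEq L] {P : L[X]}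
    (hs : P.Splits) (hsep : P.Separable) :
    ∃ Q : L[X], Q * P +
      ∑ z ∈ P.roots.toFinset, C (P.derivative.eval z)⁻¹ * (P /ₘ (X - C z)) = 1 := by
  set S := ∑ z ∈ P.roots.toFinset, C (P.derivative.eval z)⁻¹ * (P /ₘ (X - C z)) with hS
  suffices hdvd : P ∣ 1 - S by
    obtain ⟨Q, hQ⟩ := hdvd
    exact ⟨Q, by rw [mul_comm, ← hQ, sub_add_cancel]⟩
  by_cases h0 : 1 - S = 0
  · exact h0 ▸ dvd_zero P
  refine hs.dvd_of_roots_le_roots hsep.ne_zero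
    ((Multiset.le_iff_subset (nodup_roots hsep)).2 fun z hz => (mem_roots h0).2 ?_)
  have hother {y : L} (hy : y ∈ P.roots.toFinset) (hyz : y ≠ z) :
      (P /ₘ (X - C y)).eval z = 0 := by
    have hroot := congrArg (eval z)
      (mul_divByMonic_eq_iff_isRoot.2 (isRoot_of_mem_roots (Multiset.mem_toFinset.1 hy)))
    rw [(isRoot_of_mem_roots hz).eq_zero, eval_mul, eval_sub, eval_X, eval_C] at hroot
    exact (mul_eq_zero.1 hroot).resolve_left (sub_ne_zero.2 hyz.symm)
  have hself : (P /ₘ (X - C z)).eval z = P.derivative.eval z := by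
    simpa using congrArg (eval z)
      (divByMonic_add_X_sub_C_mul_derivative_divByMonic_eq_derivative P z)
  have hne : P.derivative.eval z ≠ 0 := by
    simpa using hsep.aeval_derivative_ne_zero (S := L) (x := z)
      (by simpa using (isRoot_of_mem_roots hz).eq_zero)
  rw [IsRoot.def, eval_sub, eval_one, hS, eval_finsetSum,
    Finset.sum_eq_single_of_mem z (Multiset.mem_toFinset.2 hz) fun y hy hyz => by
      rw [eval_mul, hother hy hyz, mul_zero],
    eval_mul, eval_C, hself, inv_mul_cancel₀ hne, sub_self]

theorem exists_eq_laurentExpansion_add_sum {L : Type*} [Field L] [DecidableEq L] (κ : L →+* R)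
    {P : L[X]} (hs : P.Splits) (hsep : P.Separable) (h : LaurentPolynomial R) :
    ∃ k : LaurentPolynomial R, ∀ (ε : ℤˣ) (w : HahnSeries ℤ R),
      laurentExpansion ε (toLaurent (P.map κ)) * w = laurentExpansion ε h →
      w = laurentExpansion ε k + ∑ z ∈ P.roots.toFinset,
        HahnSeries.C (κ (P.derivative.eval z)⁻¹) *
          (laurentExpansion ε (toLaurent ((P /ₘ (X - C z)).map κ)) * w) := by
  obtain ⟨Q, hQ⟩ := exists_mul_add_sum_divByMonic_eq_one hs hsep
  refine ⟨toLaurent (Q.map κ) * h, fun ε w hw => ?_⟩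
  have hQw := congrArg (fun p : L[X] => laurentExpansion ε (toLaurent (p.map κ)) * w) hQ
  simp only [Polynomial.map_add, Polynomial.map_mul, Polynomial.map_sum, Polynomial.map_one,
    Polynomial.map_C, toLaurent_C, map_add, map_mul, map_sum, map_one, one_mul, add_mul,
    Finset.sum_mul, laurentExpansion_C, mul_assoc, hw] at hQw
  rw [map_mul]
  exact hQw.symm

theorem residue_add_coeff_neg_one_sub_coeff_one_of_isRoot {L : Type*} [Field L] (κ : L →+* R)
    {P : L[X]} (hsep : P.Separable) {z : L} (hz : z ≠ 0) (hroot : P.IsRoot z)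
    (h : LaurentPolynomial R) {ρ : R} (hρ : κ (P.derivative.eval z) * ρ =
      LaurentPolynomial.eval₂ (RingHom.id R) (Units.map κ (Units.mk0 z hz)) h)
    {w₀ w₁ : HahnSeries ℤ R}
    (h₀ : laurentExpansion 1 (toLaurent (P.map κ)) * w₀ = laurentExpansion 1 h)
    (h₁ : laurentExpansion (-1) (toLaurent (P.map κ)) * w₁ = laurentExpansion (-1) h) :
    ρ + κ (P.derivative.eval z)⁻¹ *
        (laurentExpansion 1 (toLaurent ((P /ₘ (X - C z)).map κ)) * w₀).coeff (-1) -
      κ (P.derivative.eval z)⁻¹ *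
        (laurentExpansion (-1) (toLaurent ((P /ₘ (X - C z)).map κ)) * w₁).coeff 1 = 0 := by
  have hP : toLaurent (P.map κ) =
      (T 1 - LaurentPolynomial.C ((Units.map κ (Units.mk0 z hz) : Rˣ) : R)) *
        toLaurent ((P /ₘ (X - C z)).map κ) := by
    conv_lhs => rw [← mul_divByMonic_eq_iff_isRoot.2 hroot]
    rw [Polynomial.map_mul, Polynomial.map_sub, map_X, map_C, map_mul, map_sub, toLaurent_X,
      toLaurent_C]
    rfl
  have hder : κ (P.derivative.eval z)⁻¹ * κ (P.derivative.eval z) = 1 := by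
    rw [← map_mul, inv_mul_cancel₀, map_one]
    simpa using hsep.aeval_derivative_ne_zero (S := L) (x := z) (by simpa using hroot)
  rw [hP, map_mul, mul_assoc] at h₀ h₁
  have hlin := eval_add_coeff_neg_one_sub_coeff_one _ h h₀ h₁
  rw [← hρ] at hlin
  linear_combination κ (P.derivative.eval z)⁻¹ * hlin - ρ * hder

theorem sum_residues_add_coeff_neg_one_sub_coeff_one {L : Type*} [Field L] [DecidableEq L]
    (κ : L →+* R) {P : L[X]} (hs : P.Splits) (hsep : P.Separable) (h0 : P.coeff 0 ≠ 0)
    (h : LaurentPolynomial R) (ρ : L → R)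
    (hρ : ∀ (z : L) (hz : z ≠ 0), P.IsRoot z → κ (P.derivative.eval z) * ρ z =
      LaurentPolynomial.eval₂ (RingHom.id R) (Units.map κ (Units.mk0 z hz)) h)
    {w₀ w₁ : HahnSeries ℤ R}
    (h₀ : laurentExpansion 1 (toLaurent (P.map κ)) * w₀ = laurentExpansion 1 h)
    (h₁ : laurentExpansion (-1) (toLaurent (P.map κ)) * w₁ = laurentExpansion (-1) h) :
    ∑ z ∈ P.roots.toFinset, ρ z + w₀.coeff (-1) - w₁.coeff 1 = 0 := by
  obtain ⟨k, hk⟩ := exists_eq_laurentExpansion_add_sum κ hs hsep h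
  have hk₀ : (laurentExpansion 1 k).coeff (-1) = k.coeff (-1) := by
    simpa using coeff_laurentExpansion 1 k (-1)
  have hk₁ : (laurentExpansion (-1) k).coeff 1 = k.coeff (-1) := by
    simpa using coeff_laurentExpansion (-1) k (-1)
  have hsum := Finset.sum_eq_zero fun z (hz : z ∈ P.roots.toFinset) => by
    have hroot : P.IsRoot z := isRoot_of_mem_roots (Multiset.mem_toFinset.1 hz)
    have hz0 : z ≠ 0 := by
      rintro rfl
      exact h0 ((coeff_zero_eq_eval_zero P).trans hroot)
    exact residue_add_coeff_neg_one_sub_coeff_one_of_isRoot κ hsep hz0 hroot h (hρ z hz0 hroot)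
      h₀ h₁
  simp only [Finset.sum_sub_distrib, Finset.sum_add_distrib] at hsum
  rw [hk 1 w₀ h₀, hk (-1) w₁ h₁]
  simp only [HahnSeries.coeff_add, HahnSeries.coeff_sum, HahnSeries.C_mul_eq_smul,
    HahnSeries.coeff_smul, smul_eq_mul, hk₀, hk₁]
  linear_combination hsum

end CommutativeResidues

section Sections

variable {K : Type*} [Field K]

theorem SkewSeries.toLaurent_monomial (θ : RingAut K) (n : ℤ) (c : K) :
    toLaurent θ (monomial θ n c) = HahnSeries.single n (SkewLaurent.monomial θ n c) := by
  ext k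
  rw [HahnSeries.coeff_single]
  change SkewLaurent.monomial θ k ((HahnSeries.single n c).coeff k) = _
  rw [HahnSeries.coeff_single]
  split_ifs with hk
  · rw [hk]
  · exact SkewMonoidAlgebra.single_zero _

theorem SkewSeries.coeff_monomial_mul (θ : RingAut K) (n m : ℤ) (c : K) (w : SkewSeries θ) :
    (monomial θ n c * w).coeff (n + m) = c * (θ ^ n) (w.coeff m) := by
  refine monomial_inj θ (n := n + m) ?_
  have h := congrArg (HahnSeries.coeff · (n + m)) (toLaurent_mul θ (monomial θ n c) w)
  rw [toLaurent_monomial] at h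
  rw [add_comm n m, HahnSeries.coeff_single_mul_add] at h
  rw [← SkewLaurent.monomial_mul_monomial, add_comm n m]
  exact h

/-- The section `∑ a_i X^i ↦ ∑ ι(a_{m+ir}) T^i` of skew Laurent series, extending the section
operator `sec` of `𝒜` (where `r` is the order of `θ`). -/
def secSeries {R : Type*} [CommRing R] (ι : K →+* R) {θ : RingAut K} {r : ℕ} (hr : 0 < r) (m : ℤ) :
    SkewSeries θ →+ HahnSeries ℤ R where
  toFun w :=
    { coeff := fun i => ι (w.coeff (m + i * r))
      isPWO_support' := fun f => by
        obtain ⟨a, b, hab, h⟩ := w.isPWO fun n =>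
          ⟨m + (f n : ℤ) * r, fun h0 => (f n).2 (by simp [h0])⟩
        exact ⟨a, b, hab, le_of_mul_le_mul_right (le_of_add_le_add_left h) (by exact_mod_cast hr)⟩ }
  map_zero' := HahnSeries.ext (funext fun _ => map_zero ι)
  map_add' _ _ := HahnSeries.ext (funext fun _ => map_add ι _ _)

variable {R : Type*} [CommRing R] (ι : K →+* R) {θ θ' : RingAut K}

theorem coeff_secSeries {r : ℕ} (hr : 0 < r) (m : ℤ) (w : SkewSeries θ) (i : ℤ) :
    (secSeries ι hr m w).coeff i = ι (w.coeff (m + i * r)) := rfl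

theorem secSeries_monomial_mul {r : ℕ} (hr : 0 < r) (hθr : θ ^ r = 1) (m k : ℤ) (c : K)
    (w : SkewSeries θ) :
    secSeries ι hr m (SkewSeries.monomial θ (r * k) c * w) =
      HahnSeries.single k (ι c) * secSeries ι hr m w := by
  ext i
  obtain ⟨i, rfl⟩ : ∃ i', i = i' + k := ⟨i - k, by ring⟩
  rw [coeff_secSeries, HahnSeries.coeff_single_mul_add, coeff_secSeries,
    show m + (i + k) * r = r * k + (m + i * r) by ring, SkewSeries.coeff_monomial_mul,
    zpow_mul, zpow_natCast, hθr, one_zpow, map_mul, RingAut.one_apply]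

theorem secSeries_ofCentral_mul (hr : 0 < orderOf θ) (hθ' : θ' ^ orderOf θ = 1) (ε : ℤˣ)
    (E : SkewLaurent θ →+* SkewSeries θ')
    (hE : ∀ n a, E (SkewLaurent.monomial θ n a) = SkewSeries.monomial θ' (ε * n) a)
    (m : ℤ) (D : (FixedField θ)[X]) (w : SkewSeries θ') :
    secSeries ι hr m (E (SkewLaurent.ofCentral θ D) * w) =
      laurentExpansion ε (toLaurent (D.map (ι.comp (FixedField θ).subtype))) *
        secSeries ι hr m w := by
  induction D using Polynomial.induction_on' with
  | add p q hp hq => simp only [Polynomial.map_add, map_add, add_mul, hp, hq]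
  | monomial n c =>
    rw [SkewLaurent.ofCentral_monomial, hE, show (ε : ℤ) * ((orderOf θ * n : ℕ) : ℤ) =
      (orderOf θ : ℤ) * (ε * n) by push_cast; ring, secSeries_monomial_mul ι hr hθ', map_monomial,
      toLaurent_C_mul_T, ← LaurentPolynomial.single_eq_C_mul_T, laurentExpansion_single]
    rfl

theorem secSeries_eq_laurentExpansion_sec (hθ : IsOfFinOrder θ) (ε : ℤˣ)
    (E : SkewLaurent θ → SkewSeries θ') (hE : ∀ f n, (E f).coeff (ε * n) = f.coeff n) (j : ℤ)
    (f : SkewLaurent θ) :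
    secSeries ι hθ.orderOf_pos (ε * j) (E f) =
      laurentExpansion ε (AddMonoidAlgebra.mapRingHom ℤ ι (sec hθ j f)) := by
  ext i
  obtain ⟨i, rfl⟩ : ∃ i', i = (ε : ℤ) * i' := ⟨ε * i, by
    rw [← mul_assoc, ← Units.val_mul, Int.units_mul_self, Units.val_one, one_mul]⟩
  rw [coeff_secSeries, coeff_laurentExpansion, AddMonoidAlgebra.coeff_mapRingHom, coeff_sec,
    ← hE, mul_add, mul_assoc]

end Sections

section ResidueFormula

open TensorProduct

variable {K : Type*} [Field K] {θ : RingAut K} (hθ : IsOfFinOrder θ)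

theorem expandZero_mul_taylorZero (g : SkewLaurent θ) (D : nonZeroDivisors (FixedField θ)[X]) :
    expandZero θ (SkewLaurent.ofCentral θ D) * taylorZero hθ (LocalizedModule.mk g D) =
      expandZero θ g := by
  rw [taylorZero, fracLift_mk, ← mul_assoc, IsUnit.mul_val_inv, one_mul]

theorem expandInfty_mul_taylorInfty (g : SkewLaurent θ) (D : nonZeroDivisors (FixedField θ)[X]) :
    expandInfty θ (SkewLaurent.ofCentral θ D) * taylorInfty hθ (LocalizedModule.mk g D) =
      expandInfty θ g := by
  rw [taylorInfty, fracLift_mk, ← mul_assoc, IsUnit.mul_val_inv, one_mul]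

variable {R : Type*} [CommRing R] (ι : K →+* R) (j : ℕ) (g : SkewLaurent θ)
  (D : nonZeroDivisors (FixedField θ)[X])

theorem laurentExpansion_mul_secSeries_taylorZero :
    laurentExpansion 1 (toLaurent ((D : (FixedField θ)[X]).map (ι.comp (FixedField θ).subtype))) *
        secSeries ι hθ.orderOf_pos j (taylorZero hθ (LocalizedModule.mk g D)) =
      laurentExpansion 1 (AddMonoidAlgebra.mapRingHom ℤ ι (sec hθ j g)) := by
  rw [← secSeries_ofCentral_mul ι hθ.orderOf_pos (pow_orderOf_eq_one θ) 1 (expandZero θ)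
      (by simp [expandZero_monomial]), expandZero_mul_taylorZero,
    ← secSeries_eq_laurentExpansion_sec ι hθ 1 (expandZero θ) (by simp [coeff_expandZero]),
    Units.val_one, one_mul]

theorem laurentExpansion_mul_secSeries_taylorInfty :
    laurentExpansion (-1)
        (toLaurent ((D : (FixedField θ)[X]).map (ι.comp (FixedField θ).subtype))) *
        secSeries ι hθ.orderOf_pos (-j) (taylorInfty hθ (LocalizedModule.mk g D)) =
      laurentExpansion (-1) (AddMonoidAlgebra.mapRingHom ℤ ι (sec hθ j g)) := by
  rw [← secSeries_ofCentral_mul ι hθ.orderOf_pos (by rw [inv_pow, pow_orderOf_eq_one, inv_one])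
      (-1) (expandInfty θ) (by simp [expandInfty_monomial]), expandInfty_mul_taylorInfty,
    ← secSeries_eq_laurentExpansion_sec ι hθ (-1) (expandInfty θ) (by simp [coeff_expandInfty]),
    Units.val_neg, Units.val_one, neg_one_mul]

theorem map_partialResZero (f : SkewFrac θ) :
    ι (partialResZero hθ j f) = (secSeries ι hθ.orderOf_pos j (taylorZero hθ f)).coeff (-1) := by
  rw [partialResZero, coeff_secSeries, neg_one_mul, sub_eq_add_neg]

theorem map_partialResInfty (f : SkewFrac θ) :
    ι (partialResInfty hθ j f) =
      -(secSeries ι hθ.orderOf_pos (-j) (taylorInfty hθ f)).coeff 1 := by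
  rw [partialResInfty, coeff_secSeries, one_mul, neg_add_eq_sub, map_neg]

variable {Fs : Type*} [Field Fs] [Algebra (FixedField θ) Fs]

theorem iota_mk {z : Fs} (hz : z ≠ 0) (p : LaurentPolynomial K) :
    iota θ z hz (Ideal.Quotient.mk _ p) =
      LaurentPolynomial.eval₂ (RingHom.id (K ⊗[FixedField θ] Fs))
        (Units.map (Algebra.TensorProduct.includeRight :
          Fs →ₐ[FixedField θ] K ⊗[FixedField θ] Fs).toRingHom (Units.mk0 z hz))
        (AddMonoidAlgebra.mapRingHom ℤ (algebraMap K (K ⊗[FixedField θ] Fs)) p) := by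
  induction p using LaurentPolynomial.induction_on' with
  | add p q hp hq => simp only [map_add, hp, hq]
  | C_mul_T n a =>
    rw [← LaurentPolynomial.single_eq_C_mul_T, AddMonoidAlgebra.mapRingHom_single,
      LaurentPolynomial.single_eq_C_mul_T, LaurentPolynomial.single_eq_C_mul_T,
      LaurentPolynomial.eval₂_C_mul_T, iota, Ideal.Quotient.lift_mk,
      LaurentPolynomial.eval₂_C_mul_T]
    rfl

theorem sum_roots_add_partialResZero_add_partialResInfty [DecidableEq Fs]
    (hs : ((D : (FixedField θ)[X]).map (algebraMap (FixedField θ) Fs)).Splits)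
    (hsep : (D : (FixedField θ)[X]).Separable) (h0 : (D : (FixedField θ)[X]).coeff 0 ≠ 0)
    (ρ : Fs → K ⊗[FixedField θ] Fs)
    (hρ : ∀ (z : Fs) (hz : z ≠ 0), aeval z (D : (FixedField θ)[X]) = 0 →
      1 ⊗ₜ aeval z (derivative (D : (FixedField θ)[X])) * ρ z =
        iota θ z hz (Ideal.Quotient.mk _ (sec hθ j g))) :
    ∑ z ∈ ((D : (FixedField θ)[X]).aroots Fs).toFinset, ρ z +
      algebraMap K (K ⊗[FixedField θ] Fs) (partialResZero hθ j (LocalizedModule.mk g D)) +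
      algebraMap K (K ⊗[FixedField θ] Fs) (partialResInfty hθ j (LocalizedModule.mk g D)) = 0 := by
  set ι := algebraMap K (K ⊗[FixedField θ] Fs)
  let κ : Fs →+* K ⊗[FixedField θ] Fs :=
    (Algebra.TensorProduct.includeRight : Fs →ₐ[FixedField θ] K ⊗[FixedField θ] Fs).toRingHom
  set P := (D : (FixedField θ)[X]).map (algebraMap (FixedField θ) Fs) with hP
  have hκι : κ.comp (algebraMap (FixedField θ) Fs) = ι.comp (FixedField θ).subtype := by
    ext a
    exact (Algebra.TensorProduct.includeRight :
      Fs →ₐ[FixedField θ] K ⊗[FixedField θ] Fs).commutes a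
  have hPκ : P.map κ = (D : (FixedField θ)[X]).map (ι.comp (FixedField θ).subtype) := by
    rw [hP, Polynomial.map_map, hκι]
  have hP0 : P.coeff 0 ≠ 0 := by
    rwa [hP, coeff_map, map_ne_zero_iff _ (algebraMap (FixedField θ) Fs).injective]
  have hsum := sum_residues_add_coeff_neg_one_sub_coeff_one κ hs hsep.map hP0
    (AddMonoidAlgebra.mapRingHom ℤ ι (sec hθ j g)) ρ
    (fun z hz hroot => by
      rw [hP, IsRoot.def, eval_map_algebraMap] at hroot
      rw [derivative_map, eval_map_algebraMap, ← iota_mk]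
      exact hρ z hz hroot)
    (by rw [hPκ]; exact laurentExpansion_mul_secSeries_taylorZero hθ ι j g D)
    (by rw [hPκ]; exact laurentExpansion_mul_secSeries_taylorInfty hθ ι j g D)
  rw [map_partialResZero, map_partialResInfty, ← sub_eq_add_neg]
  exact hsum

end ResidueFormula

section ReducedFractions

variable {R M : Type*} [CommRing R] [AddCommGroup M] [Module R M]

/-- The fraction `m / s` of a localized module is in lowest terms: only units divide both `m` and
`s`. -/
def IsReducedFraction (m : M) (s : R) : Prop :=
  ∀ (c : R) (n : M), c ∣ s → m = c • n → IsUnit c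

theorem exists_isReducedFraction [IsDomain R] [WfDvdMonoid R] (m : M) (s : nonZeroDivisors R) :
    ∃ (m' : M) (s' : nonZeroDivisors R), (s' : R) ∣ s ∧
      LocalizedModule.mk m s = LocalizedModule.mk m' s' ∧ IsReducedFraction m' (s' : R) := by
  obtain ⟨d, hd⟩ := s
  induction d using (wellFounded_dvdNotUnit (α := R)).induction generalizing m with
  | _ d ih =>
    by_cases hred : IsReducedFraction m d
    · exact ⟨m, ⟨d, hd⟩, dvd_rfl, rfl, hred⟩
    · rw [IsReducedFraction] at hred
      push Not at hred
      obtain ⟨c, n, ⟨e, rfl⟩, rfl, hc⟩ := hred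
      obtain ⟨hcR, heR⟩ := mul_mem_nonZeroDivisors.1 hd
      obtain ⟨m', s', hdvd, hmk, hred'⟩ :=
        ih e ⟨nonZeroDivisors.ne_zero heR, c, hc, mul_comm c e⟩ n heR
      exact ⟨m', s', hdvd.mul_left c,
        (LocalizedModule.mk_cancel_common_left ⟨c, hcR⟩ ⟨e, heR⟩ n).trans hmk, hred'⟩

theorem IsReducedFraction.coeff_zero_ne_zero {K : Type*} [Field K] {θ : RingAut K}
    {g : SkewLaurent θ} {D : (FixedField θ)[X]} (h : IsReducedFraction g D) : D.coeff 0 ≠ 0 := by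
  intro h0
  refine not_isUnit_X (h X (SkewLaurent.monomial θ (-orderOf θ) 1 * g) (X_dvd_iff.2 h0) ?_)
  rw [Algebra.smul_def, SkewLaurent.algebraMap_def, SkewLaurent.ofCentral_X, SkewLaurent.Y_eq,
    ← mul_assoc, SkewLaurent.monomial_mul_monomial, add_neg_cancel, map_one, one_mul,
    ← SkewLaurent.one_def, one_mul]

end ReducedFractions

section LocalExpansions

theorem coeff_one_powerSeries_mul {B : Type*} [Semiring B] (p q : PowerSeries B) :
    PowerSeries.coeff 1 (p * q) = PowerSeries.constantCoeff p * PowerSeries.coeff 1 q +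
      PowerSeries.coeff 1 p * PowerSeries.constantCoeff q := by
  rw [PowerSeries.coeff_mul, Finset.Nat.sum_antidiagonal_eq_sum_range_succ_mk]
  simp [Finset.sum_range_succ]

theorem exists_ofPowerSeries_eq_single_mul {B : Type*} [Semiring B] {w : HahnSeries ℤ B} {n : ℤ}
    (h : n ≤ w.orderTop) : ∃ S : PowerSeries B, PowerSeries.constantCoeff S = w.coeff n ∧
      HahnSeries.ofPowerSeries ℤ B S = HahnSeries.single (-n) 1 * w := by
  refine ⟨PowerSeries.mk fun k => w.coeff (n + k), by simp, ?_⟩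
  ext i
  obtain ⟨i, rfl⟩ : ∃ i', i = i' + -n := ⟨i + n, by ring⟩
  rw [HahnSeries.coeff_single_mul_add, one_mul, PowerSeries.coeff_coe]
  split_ifs with hi
  · rw [HahnSeries.coeff_eq_zero_of_lt_orderTop]
    exact lt_of_lt_of_le (by exact_mod_cast (by omega : i < n)) h
  · rw [PowerSeries.coeff_mk]
    congr 1
    omega

variable {K : Type*} [Field K] {θ : RingAut K}

theorem SkewLaurent.ringHom_ext {B : Type*} [Semiring B] {φ ψ : SkewLaurent θ →+* B}
    (hC : ∀ a, φ (C θ a) = ψ (C θ a)) (hX : φ (X θ) = ψ (X θ)) : φ = ψ := by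
  let monomialHom : Multiplicative ℤ →* SkewLaurent θ :=
    { toFun := fun n => monomial θ n.toAdd 1
      map_one' := rfl
      map_mul' := fun m n => by simp [monomial_mul_monomial] }
  have hpow : (φ : SkewLaurent θ →* B).comp monomialHom =
      (ψ : SkewLaurent θ →* B).comp monomialHom := MonoidHom.ext_mint hX
  have hmonomial (n : ℤ) : φ (monomial θ n 1) = ψ (monomial θ n 1) :=
    DFunLike.congr_fun hpow (Multiplicative.ofAdd n)
  ext f
  induction f using SkewLaurent.induction_on with
  | h0 => rw [map_zero, map_zero]
  | hm n a =>
    have hna : monomial θ n a = C θ a * monomial θ n 1 :=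
      ((monomial_mul_monomial θ 0 n a 1).trans (by simp)).symm
    rw [hna, map_mul, map_mul, hC, hmonomial]
  | ha f g hf hg => rw [map_add, map_add, hf, hg]

namespace Admissible

variable {Fs : Type*} [Field Fs] [Algebra (FixedField θ) Fs] {z : Fs} (τ : Admissible θ z)

/-- The composite `𝒜 → lim 𝒜 / N^m 𝒜 → (𝒜 / N𝒜)[[T]]`: the morphism `expand`, with values in
power series. -/
def series : SkewLaurent θ →+* PowerSeries (SkewQuot θ (minpoly (FixedField θ) z)) :=
  τ.toRingHom.comp (toCompletion θ _)

theorem ofPowerSeries_series (g : SkewLaurent θ) :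
    HahnSeries.ofPowerSeries ℤ _ (τ.series g) = τ.expand g := rfl

theorem constantCoeff_series (g : SkewLaurent θ) :
    PowerSeries.constantCoeff (τ.series g) = Ideal.Quotient.mk _ g :=
  RingHom.congr_fun (SkewLaurent.ringHom_ext (φ := PowerSeries.constantCoeff.comp τ.series)
    (ψ := Ideal.Quotient.mk _) (fun a => by simp [series, τ.map_C]) τ.map_X) g

theorem coeff_one_series_ofCentral (D : (FixedField θ)[X]) :
    PowerSeries.coeff 1 (τ.series (SkewLaurent.ofCentral θ D)) =
      Ideal.Quotient.mk _ (SkewLaurent.ofCentral θ (derivative D)) := by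
  have hX : PowerSeries.coeff 1 (τ.series (SkewLaurent.ofCentral θ X)) = 1 := by
    simp [series, SkewLaurent.ofCentral_X, τ.map_Y]
  induction D using Polynomial.induction_on with
  | C a => simp [series, SkewLaurent.ofCentral_C, τ.map_C]
  | add p q hp hq => simp only [map_add, hp, hq]
  | monomial n a h =>
    rw [pow_succ, ← mul_assoc, derivative_mul, derivative_X, mul_one, map_mul, map_mul,
      coeff_one_powerSeries_mul, constantCoeff_series, constantCoeff_series, hX, h, mul_one,
      add_comm, ← map_mul, ← map_mul, ← map_add, ← map_add]

variable [IsSepClosure (FixedField θ) Fs] {g : SkewLaurent θ}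
  {D : nonZeroDivisors (FixedField θ)[X]}

theorem expand_mul_taylor :
    τ.expand (SkewLaurent.ofCentral θ D) * τ.taylor (LocalizedModule.mk g D) = τ.expand g := by
  rw [taylor, fracLift_mk, ← mul_assoc, IsUnit.mul_val_inv, one_mul]

theorem exists_series_eq (h : ((-1 : ℤ) : WithTop ℤ) ≤ τ.ord (LocalizedModule.mk g D)) :
    ∃ S : PowerSeries (SkewQuot θ (minpoly (FixedField θ) z)),
      PowerSeries.constantCoeff S = τ.sres (LocalizedModule.mk g D) ∧
      τ.series (SkewLaurent.ofCentral θ D) * S = PowerSeries.X * τ.series g := by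
  obtain ⟨S, hS, hw⟩ := exists_ofPowerSeries_eq_single_mul h
  refine ⟨S, hS, HahnSeries.ofPowerSeries_injective (Γ := ℤ) ?_⟩
  have hX : HahnSeries.single (- -1 : ℤ) 1 = HahnSeries.ofPowerSeries ℤ
      (SkewQuot θ (minpoly (FixedField θ) z)) PowerSeries.X := HahnSeries.ofPowerSeries_X.symm
  rw [map_mul, hw, hX, ← mul_assoc, ← map_mul, ← PowerSeries.X_mul, map_mul, mul_assoc,
    ofPowerSeries_series, expand_mul_taylor, map_mul, ofPowerSeries_series]

theorem mk_ofCentral_mul_sres (h : ((-1 : ℤ) : WithTop ℤ) ≤ τ.ord (LocalizedModule.mk g D)) :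
    Ideal.Quotient.mk _ (SkewLaurent.ofCentral θ D) * τ.sres (LocalizedModule.mk g D) = 0 := by
  obtain ⟨S, hS, hE⟩ := τ.exists_series_eq h
  simpa [constantCoeff_series, hS] using congrArg PowerSeries.constantCoeff hE

theorem mk_ofCentral_derivative_mul_sres
    (h : ((-1 : ℤ) : WithTop ℤ) ≤ τ.ord (LocalizedModule.mk g D))
    (hD : Ideal.Quotient.mk (centralIdeal θ (minpoly (FixedField θ) z))
      (SkewLaurent.ofCentral θ D) = 0) :
    Ideal.Quotient.mk _ (SkewLaurent.ofCentral θ (derivative (D : (FixedField θ)[X]))) *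
      τ.sres (LocalizedModule.mk g D) = Ideal.Quotient.mk _ g := by
  obtain ⟨S, hS, hE⟩ := τ.exists_series_eq h
  simpa [coeff_one_powerSeries_mul, constantCoeff_series, hS, hD, coeff_one_series_ofCentral] using
    congrArg (PowerSeries.coeff 1) hE

end Admissible

end LocalExpansions

section NonzeroPoints

open TensorProduct

variable {K : Type*} [Field K] {θ : RingAut K} {Fs : Type*} [Field Fs] [Algebra (FixedField θ) Fs]
  {z : Fs}

theorem mk_ofCentral_eq_zero {D : (FixedField θ)[X]} (hD : aeval z D = 0) :
    Ideal.Quotient.mk (centralIdeal θ (minpoly (FixedField θ) z))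
      (SkewLaurent.ofCentral θ D) = 0 := by
  obtain ⟨E, rfl⟩ := minpoly.dvd _ _ hD
  rw [Ideal.Quotient.eq_zero_iff_mem, map_mul, (SkewLaurent.ofCentral_comm θ _ _).eq]
  exact Ideal.mul_mem_left _ _ (Ideal.mem_span_singleton_self _)

theorem iota_mk_centralToLaurent (hz : z ≠ 0) (D : (FixedField θ)[X]) :
    iota θ z hz (Ideal.Quotient.mk _ (centralToLaurent θ D)) = 1 ⊗ₜ aeval z D := by
  rw [iota, Ideal.Quotient.lift_mk, centralToLaurent, RingHom.comp_apply,
    LaurentPolynomial.eval₂_toLaurent, Polynomial.coe_mapRingHom, eval₂_map]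
  exact aeval_algHom_apply (Algebra.TensorProduct.includeRight :
    Fs →ₐ[FixedField θ] K ⊗[FixedField θ] Fs) z D

theorem iota_secQuot_ofCentral_mul (hθ : IsOfFinOrder θ) (hz : z ≠ 0) (j : ℤ)
    (D : (FixedField θ)[X]) (s : SkewQuot θ (minpoly (FixedField θ) z)) :
    iota θ z hz (secQuot hθ j _ (Ideal.Quotient.mk _ (SkewLaurent.ofCentral θ D) * s)) =
      1 ⊗ₜ aeval z D * iota θ z hz (secQuot hθ j _ s) := by
  obtain ⟨g, rfl⟩ := Ideal.Quotient.mk_surjective s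
  rw [← map_mul]
  change iota θ z hz (Ideal.Quotient.mk _ (sec hθ j _)) =
    _ * iota θ z hz (Ideal.Quotient.mk _ (sec hθ j g))
  rw [sec_ofCentral_mul, map_mul, map_mul, iota_mk_centralToLaurent]

variable [IsSepClosure (FixedField θ) Fs] {g : SkewLaurent θ}
  {D : nonZeroDivisors (FixedField θ)[X]}

namespace Admissible

variable (τ : Admissible θ z) (hθ : IsOfFinOrder θ) (hz : z ≠ 0) (j : ℕ)

include τ in
theorem mk_eq_zero_of_aeval_derivative_eq_zero
    (h : ((-1 : ℤ) : WithTop ℤ) ≤ τ.ord (LocalizedModule.mk g D))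
    (hD : aeval z (D : (FixedField θ)[X]) = 0)
    (hD' : aeval z (derivative (D : (FixedField θ)[X])) = 0) :
    Ideal.Quotient.mk (centralIdeal θ (minpoly (FixedField θ) z)) g = 0 := by
  rw [← τ.mk_ofCentral_derivative_mul_sres h (mk_ofCentral_eq_zero hD),
    mk_ofCentral_eq_zero hD', zero_mul]

theorem partialRes_eq_zero (h : ((-1 : ℤ) : WithTop ℤ) ≤ τ.ord (LocalizedModule.mk g D))
    (hD : aeval z (D : (FixedField θ)[X]) ≠ 0) :
    τ.partialRes hθ hz j (LocalizedModule.mk g D) = 0 := by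
  have hunit : IsUnit (1 ⊗ₜ aeval z (D : (FixedField θ)[X]) : K ⊗[FixedField θ] Fs) :=
    hD.isUnit.map (Algebra.TensorProduct.includeRight :
      Fs →ₐ[FixedField θ] K ⊗[FixedField θ] Fs)
  rw [← hunit.mul_right_eq_zero, partialRes, ← iota_secQuot_ofCentral_mul,
    τ.mk_ofCentral_mul_sres h, map_zero, map_zero]

theorem tmul_aeval_derivative_mul_partialRes
    (h : ((-1 : ℤ) : WithTop ℤ) ≤ τ.ord (LocalizedModule.mk g D))
    (hD : aeval z (D : (FixedField θ)[X]) = 0) :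
    1 ⊗ₜ aeval z (derivative (D : (FixedField θ)[X])) *
      τ.partialRes hθ hz j (LocalizedModule.mk g D) =
        iota θ z hz (Ideal.Quotient.mk _ (sec hθ j g)) := by
  rw [partialRes, ← iota_secQuot_ofCentral_mul,
    τ.mk_ofCentral_derivative_mul_sres h (mk_ofCentral_eq_zero hD)]
  rfl

end Admissible

theorem IsReducedFraction.separable (hred : IsReducedFraction g (D : (FixedField θ)[X]))
    (hs : ((D : (FixedField θ)[X]).map (algebraMap (FixedField θ) Fs)).Splits)
    (τ : ∀ z : Fs, z ≠ 0 → Admissible θ z)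
    (h : ∀ (z : Fs) (hz : z ≠ 0), ((-1 : ℤ) : WithTop ℤ) ≤ (τ z hz).ord (LocalizedModule.mk g D)) :
    (D : (FixedField θ)[X]).Separable := by
  have hD0 : (D : (FixedField θ)[X]) ≠ 0 := nonZeroDivisors.coe_ne_zero D
  refine (nodup_aroots_iff_of_splits hD0 hs).1 ?_
  classical
  rw [Multiset.nodup_iff_count_le_one]
  intro z
  rw [count_roots]
  by_contra! hmult
  obtain ⟨hroot, hroot'⟩ := (one_lt_rootMultiplicity_iff_isRoot
    ((Polynomial.map_ne_zero_iff (algebraMap (FixedField θ) Fs).injective).2 hD0)).1 hmult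
  rw [derivative_map] at hroot'
  rw [IsRoot, eval_map_algebraMap] at hroot hroot'
  have hz : z ≠ 0 := by
    rintro rfl
    rw [aeval_def, eval₂_at_zero, map_eq_zero] at hroot
    exact hred.coeff_zero_ne_zero hroot
  obtain ⟨n, hn⟩ := Ideal.mem_span_singleton'.1 (Ideal.Quotient.eq_zero_iff_mem.1
    ((τ z hz).mk_eq_zero_of_aeval_derivative_eq_zero (h z hz) hroot hroot'))
  refine minpoly.not_isUnit (FixedField θ) z (hred _ n (minpoly.dvd _ _ hroot) ?_)
  rw [Algebra.smul_def, SkewLaurent.algebraMap_def, (SkewLaurent.ofCentral_comm θ _ _).eq, hn]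

end NonzeroPoints

section Norms

theorem prod_range_succ_eq_prod_range {M : Type*} [CommMonoid M] {f : ℕ → M} {n : ℕ}
    (h : f n = f 0) : ∏ i ∈ Finset.range n, f (i + 1) = ∏ i ∈ Finset.range n, f i := by
  cases n with
  | zero => rfl
  | succ n => rw [Finset.prod_range_succ, h, Finset.prod_range_succ']

theorem smul_prod_range_orderOf_pow_smul {G M : Type*} [Monoid G] [CommMonoid M]
    [MulDistribMulAction G M] (g : G) (m : M) :
    g • ∏ i ∈ Finset.range (orderOf g), g ^ i • m =
      ∏ i ∈ Finset.range (orderOf g), g ^ i • m := by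
  rw [Finset.smul_prod']
  simp only [smul_smul, ← pow_succ']
  exact prod_range_succ_eq_prod_range (f := fun i => g ^ i • m)
    (by rw [pow_orderOf_eq_one, pow_zero])

theorem map_mul_pow_eq_map_prod_mul_pow {G M A : Type*} [Monoid G] [CommMonoid M] [MulAction G M]
    [Monoid A] (Φ : M →* A) {g : G} {ξ : A} (h : ∀ m, ξ * Φ m = Φ (g • m) * ξ) (m : M) (n : ℕ) :
    (Φ m * ξ) ^ n = Φ (∏ i ∈ Finset.range n, g ^ i • m) * ξ ^ n := by
  have hpow (n : ℕ) (m : M) : ξ ^ n * Φ m = Φ (g ^ n • m) * ξ ^ n := by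
    induction n generalizing m with
    | zero => simp
    | succ n ih => rw [pow_succ, mul_assoc, h, ← mul_assoc, ih, mul_assoc, pow_succ, mul_smul]
  induction n with
  | zero => simp
  | succ n ih =>
    rw [pow_succ, ih, mul_assoc, ← mul_assoc (ξ ^ n), hpow, Finset.prod_range_succ, map_mul,
      pow_succ, mul_assoc, mul_assoc]

theorem coeff_zero_prod_one_add_C_mul_X {R ι : Type*} [CommSemiring R] (s : Finset ι) (a : ι → R) :
    (∏ i ∈ s, (1 + C (a i) * X)).coeff 0 = 1 := by
  simp [coeff_zero_eq_eval_zero, eval_prod]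

theorem coeff_one_prod_one_add_C_mul_X {R ι : Type*} [CommSemiring R] (s : Finset ι) (a : ι → R) :
    (∏ i ∈ s, (1 + C (a i) * X)).coeff 1 = ∑ i ∈ s, a i := by
  classical
  induction s using Finset.induction_on with
  | empty => simp [coeff_one]
  | insert i s hi ih =>
    rw [Finset.prod_insert hi, mul_coeff_one, ih, coeff_zero_prod_one_add_C_mul_X,
      Finset.sum_insert hi]
    simp [coeff_one, add_comm]

variable {K : Type*} [Field K] {θ : RingAut K}

theorem exists_sum_pow_apply_ne_zero (hθ : IsOfFinOrder θ) :
    ∃ a : K, ∑ i ∈ Finset.range (orderOf θ), (θ ^ i) a ≠ 0 := by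
  have hinj : Function.Injective
      fun i : Fin (orderOf θ) => ((θ ^ (i : ℕ) : RingAut K) : K →* K) := by
    intro i k h
    have hpow : θ ^ (i : ℕ) = θ ^ (k : ℕ) := RingEquiv.ext fun a => DFunLike.congr_fun h a
    exact Fin.ext (pow_injOn_Iio_orderOf i.2 k.2 hpow)
  by_contra! h
  have hone := Fintype.linearIndependent_iff.1 ((linearIndependent_monoidHom K K).comp _ hinj)
    (fun _ => 1) (by
      ext a
      refine Eq.trans ?_ (h a)
      rw [Finset.sum_range]
      simp)
  exact one_ne_zero (hone ⟨0, hθ.orderOf_pos⟩)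

theorem exists_map_eq_of_smul_eq {p : K[X]} (hp : θ • p = p) :
    ∃ P : (FixedField θ)[X], P.map (FixedField θ).subtype = p := by
  rw [← mem_lifts, lifts_iff_coeff_lifts]
  exact fun n => ⟨⟨p.coeff n, congrArg (coeff · n) hp⟩, rfl⟩

theorem exists_map_eq_prod_pow_smul (hθ : IsOfFinOrder θ) :
    ∃ (a : K) (P : (FixedField θ)[X]), P.coeff 0 = 1 ∧ P.coeff 1 ≠ 0 ∧
      P.map (FixedField θ).subtype =
        ∏ i ∈ Finset.range (orderOf θ), θ ^ i • (1 + C a * X : K[X]) := by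
  obtain ⟨a, ha⟩ := exists_sum_pow_apply_ne_zero hθ
  obtain ⟨P, hP⟩ :=
    exists_map_eq_of_smul_eq (smul_prod_range_orderOf_pow_smul θ (1 + C a * X : K[X]))
  have hsmul (i : ℕ) : θ ^ i • (1 + C a * X : K[X]) = 1 + C ((θ ^ i) a) * X := by
    rw [smul_add, smul_one, smul_mul', smul_C, smul_X, RingAut.smul_def]
  have hcoeff (n : ℕ) :
      (P.coeff n : K) = (∏ i ∈ Finset.range (orderOf θ), (1 + C ((θ ^ i) a) * X)).coeff n := by
    simp only [← hsmul, ← hP, coeff_map]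
    rfl
  refine ⟨a, P, Subtype.ext ?_, fun h => ha ?_, hP⟩
  · rw [hcoeff, coeff_zero_prod_one_add_C_mul_X]
    rfl
  · rw [← coeff_one_prod_one_add_C_mul_X, ← hcoeff, h]
    rfl

end Norms

section Hensel

theorem exists_isRoot_of_isUnit_leadingCoeff {R : Type*} [CommRing R] {I : Ideal R}
    [HenselianRing R I] {f : R[X]} (hf : IsUnit f.leadingCoeff) {a₀ : R} (h : f.eval a₀ ∈ I)
    (h' : IsUnit (Ideal.Quotient.mk I (f.derivative.eval a₀))) :
    ∃ a, f.IsRoot a ∧ a - a₀ ∈ I := by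
  obtain ⟨c, hc⟩ := isUnit_iff_exists_inv'.1 hf
  have hcu : IsUnit c := IsUnit.of_mul_eq_one _ hc
  obtain ⟨a, ha, haI⟩ := HenselianRing.is_henselian (I := I) (C c * f)
    (monic_C_mul_of_mul_leadingCoeff_eq_one hc) a₀
    (by rw [eval_C_mul]; exact I.mul_mem_left _ h)
    (by rw [derivative_C_mul, eval_C_mul, map_mul]; exact (hcu.map _).mul h')
  rw [IsRoot, eval_C_mul, hcu.mul_right_eq_zero] at ha
  exact ⟨a, ha, haI⟩

theorem exists_eval₂_powerSeries_eq {L : Type*} [Field L] {P : L[X]} (h1 : P.coeff 1 ≠ 0)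
    {S : PowerSeries L} (hS : PowerSeries.constantCoeff S = P.coeff 0) :
    ∃ t : PowerSeries L, PowerSeries.constantCoeff t = 0 ∧ P.eval₂ PowerSeries.C t = S := by
  have hinj : Function.Injective (PowerSeries.C : L →+* PowerSeries L) := RingHom.injective _
  have hdeg : 0 < P.degree :=
    natDegree_pos_iff_degree_pos.1 (le_natDegree_of_ne_zero h1)
  have hlead : (P.map PowerSeries.C - C S).leadingCoeff = PowerSeries.C P.leadingCoeff := by
    rw [leadingCoeff_sub_of_degree_lt, leadingCoeff_map_of_injective hinj]
    rw [degree_map_eq_of_injective hinj]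
    exact degree_C_le.trans_lt hdeg
  obtain ⟨t, ht, ht0⟩ := exists_isRoot_of_isUnit_leadingCoeff (I := Ideal.span {PowerSeries.X})
    (f := P.map PowerSeries.C - C S) (a₀ := 0)
    (hlead ▸ (leadingCoeff_ne_zero.2 (ne_zero_of_degree_gt hdeg)).isUnit.map PowerSeries.C)
    (by
      rw [Ideal.mem_span_singleton, PowerSeries.X_dvd_iff]
      simp [hS, eval_map])
    (by
      refine IsUnit.map _ ?_
      rw [← coeff_zero_eq_eval_zero, coeff_derivative]
      simpa using h1)
  refine ⟨t, ?_, ?_⟩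
  · rwa [sub_zero, Ideal.mem_span_singleton, PowerSeries.X_dvd_iff] at ht0
  · rwa [IsRoot, eval_sub, eval_C, eval_map, sub_eq_zero] at ht

end Hensel

section Lifts

variable {K : Type*} [Field K] {θ : RingAut K} {B : Type*} [Ring B]

theorem zpow_mul_map (φ : K →+* B) {x : Bˣ} (hx : ∀ a, (x : B) * φ a = φ (θ a) * x) (n : ℤ)
    (a : K) : ((x ^ n : Bˣ) : B) * φ a = φ ((θ ^ n) a) * ((x ^ n : Bˣ) : B) := by
  have hinv (a : K) : ((x⁻¹ : Bˣ) : B) * φ a = φ (θ⁻¹ a) * ((x⁻¹ : Bˣ) : B) := by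
    rw [Units.inv_mul_eq_iff_eq_mul, ← mul_assoc, hx, mul_assoc, Units.mul_inv, mul_one,
      ← RingAut.mul_apply, mul_inv_cancel]
    rfl
  induction n using Int.induction_on generalizing a with
  | zero => simp
  | succ n ih =>
    rw [zpow_add_one, zpow_add_one, Units.val_mul, mul_assoc, hx, ← mul_assoc, ih, mul_assoc,
      RingAut.mul_apply]
  | pred n ih =>
    rw [zpow_sub_one, zpow_sub_one, Units.val_mul, mul_assoc, hinv, ← mul_assoc, ih, mul_assoc,
      RingAut.mul_apply]

namespace SkewLaurent

/-- The universal property of the ring of skew Laurent polynomials: a morphism on `K` extends to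
`𝒜` by sending `X` to any unit satisfying the commutation rule of `X`. -/
def lift (φ : K →+* B) (x : Bˣ) (hx : ∀ a, (x : B) * φ a = φ (θ a) * x) : SkewLaurent θ →+* B :=
  letI := zAction θ
  SkewMonoidAlgebra.liftNCRingHom φ ((Units.coeHom B).comp (zpowersHom Bˣ x)) @fun a n =>
    (zpow_mul_map φ hx n.toAdd a).symm

variable (φ : K →+* B) (x : Bˣ) (hx : ∀ a, (x : B) * φ a = φ (θ a) * x)

theorem lift_monomial (n : ℤ) (a : K) :
    lift φ x hx (monomial θ n a) = φ a * ((x ^ n : Bˣ) : B) :=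
  letI := zAction θ
  SkewMonoidAlgebra.liftNC_single (φ : K →+ B) ((Units.coeHom B).comp (zpowersHom Bˣ x)) n a

theorem lift_C (a : K) : lift φ x hx (C θ a) = φ a :=
  (lift_monomial φ x hx 0 a).trans (by rw [zpow_zero, Units.val_one, mul_one])

theorem lift_X : lift φ x hx (X θ) = x :=
  (lift_monomial φ x hx 1 1).trans (by rw [zpow_one, map_one, one_mul])

end SkewLaurent

variable {N : (FixedField θ)[X]} (Ψ : SkewLaurent θ →+* PowerSeries B)
  (hN : PowerSeries.constantCoeff (Ψ (SkewLaurent.ofCentral θ N)) = 0)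

include hN in
theorem coeff_eq_zero_of_mem_centralIdeal_pow {m n : ℕ} (hn : n < m) {g : SkewLaurent θ}
    (hg : g ∈ centralIdeal θ (N ^ m)) : PowerSeries.coeff n (Ψ g) = 0 := by
  obtain ⟨c, rfl⟩ := Ideal.mem_span_singleton'.1 hg
  obtain ⟨E, hE⟩ := PowerSeries.X_dvd_iff.2 hN
  refine PowerSeries.X_pow_dvd_iff.1 ⟨Ψ c * E ^ m, ?_⟩ n hn
  rw [map_mul, map_pow, map_pow, hE, (PowerSeries.commute_X E).symm.mul_pow, ← mul_assoc,
    ← mul_assoc, PowerSeries.X_pow_mul]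

/-- The additive map underlying `completionLift`: the coefficient of `T^n` only depends on the
class modulo `N^(n+1)`. -/
def completionLiftAddHom : completion θ N →+ PowerSeries B where
  toFun f := PowerSeries.mk fun n =>
    QuotientAddGroup.lift (centralIdeal θ (N ^ (n + 1))).toAddSubgroup
      ((PowerSeries.coeff n).toAddMonoidHom.comp Ψ.toAddMonoidHom)
      (fun _ => coeff_eq_zero_of_mem_centralIdeal_pow Ψ hN n.lt_succ_self) (f.1 (n + 1))
  map_zero' := PowerSeries.ext fun n => by
    rw [PowerSeries.coeff_mk]
    exact map_zero _
  map_add' f g := PowerSeries.ext fun n => by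
    rw [map_add, PowerSeries.coeff_mk, PowerSeries.coeff_mk, PowerSeries.coeff_mk]
    exact map_add _ _ _

theorem coeff_completionLiftAddHom {f : completion θ N} {m n : ℕ} (hn : n < m)
    {g : SkewLaurent θ} (hg : Ideal.Quotient.mk _ g = f.1 m) :
    PowerSeries.coeff n (completionLiftAddHom Ψ hN f) = PowerSeries.coeff n (Ψ g) := by
  have hf : f.1 (n + 1) = Ideal.Quotient.mk _ g := by
    rw [← f.2 (n + 1) m hn, ← hg]
    rfl
  rw [completionLiftAddHom, AddMonoidHom.coe_mk, ZeroHom.coe_mk, PowerSeries.coeff_mk, hf]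
  rfl

theorem completionLiftAddHom_toCompletion (g : SkewLaurent θ) :
    completionLiftAddHom Ψ hN (toCompletion θ N g) = Ψ g :=
  PowerSeries.ext fun n => coeff_completionLiftAddHom Ψ hN n.lt_succ_self rfl

/-- The extension to `lim 𝒜 / N^m 𝒜` of a morphism `𝒜 → B[[T]]` that sends `N` to a multiple of
`T`. -/
def completionLift : completion θ N →+* PowerSeries B where
  __ := completionLiftAddHom Ψ hN
  map_one' := by
    rw [← map_one Ψ, ← completionLiftAddHom_toCompletion Ψ hN, map_one]
    rfl
  map_mul' f g := PowerSeries.ext fun n => by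
    obtain ⟨f₀, hf₀⟩ := Ideal.Quotient.mk_surjective (f.1 (n + 1))
    obtain ⟨g₀, hg₀⟩ := Ideal.Quotient.mk_surjective (g.1 (n + 1))
    change PowerSeries.coeff n (completionLiftAddHom Ψ hN (f * g)) =
      PowerSeries.coeff n (completionLiftAddHom Ψ hN f * completionLiftAddHom Ψ hN g)
    rw [coeff_completionLiftAddHom Ψ hN n.lt_succ_self (g := f₀ * g₀) (by
      rw [map_mul, hf₀, hg₀]; rfl), map_mul, PowerSeries.coeff_mul, PowerSeries.coeff_mul]
    refine Finset.sum_congr rfl fun p hp => ?_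
    have hpn := Finset.HasAntidiagonal.mem_antidiagonal.1 hp
    rw [coeff_completionLiftAddHom Ψ hN (by omega) hf₀,
      coeff_completionLiftAddHom Ψ hN (by omega) hg₀]

theorem completionLift_toCompletion (g : SkewLaurent θ) :
    completionLift Ψ hN (toCompletion θ N g) = Ψ g :=
  completionLiftAddHom_toCompletion Ψ hN g

end Lifts

section Existence

variable {K : Type*} [Field K] {θ : RingAut K}

variable (θ) in
/-- The map `F[Y] / N → 𝒜 / N𝒜`, whose image is central. -/
def centerQuot (N : (FixedField θ)[X]) : AdjoinRoot N →+* SkewQuot θ N :=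
  Ideal.Quotient.lift (Ideal.span {N})
    ((Ideal.Quotient.mk (centralIdeal θ N)).comp (SkewLaurent.ofCentral θ)) (by
      intro a ha
      obtain ⟨c, rfl⟩ := Ideal.mem_span_singleton'.1 ha
      rw [RingHom.comp_apply, map_mul, Ideal.Quotient.eq_zero_iff_mem]
      exact Ideal.mul_mem_left _ _ (Ideal.mem_span_singleton_self _))

variable {N : (FixedField θ)[X]}

theorem centerQuot_of (c : FixedField θ) :
    centerQuot θ N (AdjoinRoot.of N c) = Ideal.Quotient.mk _ (SkewLaurent.C θ c) :=
  congrArg (Ideal.Quotient.mk (centralIdeal θ N)) (SkewLaurent.ofCentral_C θ c)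

theorem centerQuot_root :
    centerQuot θ N (AdjoinRoot.root N) = Ideal.Quotient.mk _ (SkewLaurent.Y θ) :=
  congrArg (Ideal.Quotient.mk (centralIdeal θ N)) (SkewLaurent.ofCentral_X θ)

theorem centerQuot_commute (l : AdjoinRoot N) (b : SkewQuot θ N) :
    Commute (centerQuot θ N l) b := by
  obtain ⟨p, rfl⟩ := AdjoinRoot.mk_surjective l
  obtain ⟨b, rfl⟩ := Ideal.Quotient.mk_surjective b
  exact (SkewLaurent.ofCentral_comm θ p b).map (Ideal.Quotient.mk (centralIdeal θ N))

theorem C_commute_map_centerQuot (b : SkewQuot θ N) (t : PowerSeries (AdjoinRoot N)) :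
    Commute (PowerSeries.C b) (PowerSeries.map (centerQuot θ N) t) := by
  ext n
  rw [PowerSeries.coeff_mul_C, PowerSeries.coeff_C_mul, PowerSeries.coeff_map]
  exact (centerQuot_commute _ b).symm

/-- The evaluation `p ↦ p(t)` of polynomials over `K` at a power series `t` with coefficients in
`F[Y] / N`. It takes its values in `(𝒜 / N𝒜)[[T]]`, where `t` is central. -/
def evalCentral (t : PowerSeries (AdjoinRoot N)) : K[X] →+* PowerSeries (SkewQuot θ N) :=
  eval₂RingHom' (PowerSeries.C.comp ((Ideal.Quotient.mk (centralIdeal θ N)).comp (SkewLaurent.C θ)))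
    (PowerSeries.map (centerQuot θ N) t) fun _ => C_commute_map_centerQuot _ t

variable (t : PowerSeries (AdjoinRoot N))

theorem evalCentral_C (a : K) :
    evalCentral t (C a) = PowerSeries.C (Ideal.Quotient.mk _ (SkewLaurent.C θ a)) :=
  eval₂_C _ _

theorem evalCentral_X : evalCentral t X = PowerSeries.map (centerQuot θ N) t :=
  eval₂_X _ _

theorem evalCentral_map_subtype (P : (FixedField θ)[X]) :
    evalCentral t (P.map (FixedField θ).subtype) =
      PowerSeries.map (centerQuot θ N) ((P.map (AdjoinRoot.of N)).eval₂ PowerSeries.C t) := by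
  have hext : (evalCentral t).comp (mapRingHom (FixedField θ).subtype) =
      (PowerSeries.map (centerQuot θ N)).comp
        ((eval₂RingHom PowerSeries.C t).comp (mapRingHom (AdjoinRoot.of N))) := by
    refine Polynomial.ringHom_ext (fun c => ?_) ?_
    · simp [evalCentral_C, centerQuot_of]
    · simp [evalCentral_X]
  exact RingHom.congr_fun hext P

theorem C_mk_X_mul_evalCentral (p : K[X]) :
    PowerSeries.C (Ideal.Quotient.mk _ (SkewLaurent.X θ)) * evalCentral t p =
      evalCentral t (θ • p) * PowerSeries.C (Ideal.Quotient.mk _ (SkewLaurent.X θ)) := by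
  induction p using Polynomial.induction_on with
  | C a =>
    have hcomm : SkewLaurent.X θ * SkewLaurent.C θ a = SkewLaurent.C θ (θ a) * SkewLaurent.X θ :=
      (SkewLaurent.monomial_mul_monomial θ 1 0 1 a).trans
        (Eq.trans (by simp) (SkewLaurent.monomial_mul_monomial θ 0 1 (θ a) 1).symm)
    rw [smul_C, RingAut.smul_def, evalCentral_C, evalCentral_C, ← map_mul, ← map_mul, ← map_mul,
      ← map_mul, hcomm]
  | add p q hp hq => rw [smul_add, map_add, map_add, mul_add, add_mul, hp, hq]
  | monomial n a h =>
    rw [pow_succ, ← mul_assoc, smul_mul', smul_X, map_mul, map_mul _ _ X, ← mul_assoc, h,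
      mul_assoc, mul_assoc, evalCentral_X, (C_commute_map_centerQuot _ t).eq]

theorem exists_unit_pow_orderOf_eq (hθ : IsOfFinOrder θ) [Fact (Irreducible N)]
    (hN : AdjoinRoot.root N ≠ 0) :
    ∃ x : (PowerSeries (SkewQuot θ N))ˣ,
      PowerSeries.constantCoeff (x : PowerSeries (SkewQuot θ N)) =
        Ideal.Quotient.mk _ (SkewLaurent.X θ) ∧
      (x : PowerSeries (SkewQuot θ N)) ^ orderOf θ =
        PowerSeries.C (Ideal.Quotient.mk _ (SkewLaurent.Y θ)) + PowerSeries.X ∧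
      ∀ a : K, (x : PowerSeries (SkewQuot θ N)) *
          PowerSeries.C (Ideal.Quotient.mk _ (SkewLaurent.C θ a)) =
        PowerSeries.C (Ideal.Quotient.mk _ (SkewLaurent.C θ (θ a))) *
          (x : PowerSeries (SkewQuot θ N)) := by
  obtain ⟨e, P, hP0, hP1, hP⟩ := exists_map_eq_prod_pow_smul hθ
  obtain ⟨t, ht0, ht⟩ := exists_eval₂_powerSeries_eq (P := P.map (AdjoinRoot.of N))
    (S := 1 + PowerSeries.C (AdjoinRoot.root N)⁻¹ * PowerSeries.X)
    (by rwa [coeff_map, _root_.map_ne_zero]) (by simp [hP0])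
  set ξ : PowerSeries (SkewQuot θ N) := PowerSeries.C (Ideal.Quotient.mk _ (SkewLaurent.X θ))
    with hξ
  have hpow : (evalCentral t (1 + C e * X) * ξ) ^ orderOf θ = PowerSeries.map (centerQuot θ N)
      (PowerSeries.C (AdjoinRoot.root N) + PowerSeries.X) := by
    have hξpow : ξ ^ orderOf θ =
        PowerSeries.map (centerQuot θ N) (PowerSeries.C (AdjoinRoot.root N)) := by
      rw [hξ, ← map_pow, ← map_pow, PowerSeries.map_C, centerQuot_root, SkewLaurent.Y]
    refine (map_mul_pow_eq_map_prod_mul_pow (evalCentral t : K[X] →* PowerSeries (SkewQuot θ N))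
      (C_mk_X_mul_evalCentral t) (1 + C e * X) (orderOf θ)).trans ?_
    rw [← hP, MonoidHom.coe_coe, evalCentral_map_subtype, ht, hξpow, ← map_mul, add_mul, one_mul,
      mul_right_comm, ← map_mul, inv_mul_cancel₀ hN, map_one, one_mul]
  have hunit : IsUnit (evalCentral t (1 + C e * X) * ξ) := by
    refine (isUnit_pow_iff hθ.orderOf_pos.ne').1 (hpow ▸ IsUnit.map _ ?_)
    rw [PowerSeries.isUnit_iff_constantCoeff]
    simpa using hN
  refine ⟨hunit.unit, ?_, ?_, fun a => ?_⟩
  · have ht0' : PowerSeries.constantCoeff (PowerSeries.map (centerQuot θ N) t) = 0 := by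
      rw [← PowerSeries.coeff_zero_eq_constantCoeff_apply, PowerSeries.coeff_map,
        PowerSeries.coeff_zero_eq_constantCoeff_apply, ht0, map_zero]
    simp [evalCentral_X, hξ, ht0']
  · rw [IsUnit.unit_spec, hpow, map_add, PowerSeries.map_C, PowerSeries.map_X, centerQuot_root]
  · rw [IsUnit.unit_spec, ← evalCentral_C t, ← evalCentral_C t, mul_assoc,
      C_mk_X_mul_evalCentral, smul_C, RingAut.smul_def, ← mul_assoc, ← mul_assoc, ← map_mul,
      ← map_mul, mul_comm]

theorem exists_ringHom_powerSeries (hθ : IsOfFinOrder θ) [Fact (Irreducible N)]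
    (hN : AdjoinRoot.root N ≠ 0) :
    ∃ Ψ : SkewLaurent θ →+* PowerSeries (SkewQuot θ N),
      (∀ a, Ψ (SkewLaurent.C θ a) = PowerSeries.C (Ideal.Quotient.mk _ (SkewLaurent.C θ a))) ∧
      PowerSeries.constantCoeff (Ψ (SkewLaurent.X θ)) = Ideal.Quotient.mk _ (SkewLaurent.X θ) ∧
      Ψ (SkewLaurent.Y θ) =
        PowerSeries.C (Ideal.Quotient.mk _ (SkewLaurent.Y θ)) + PowerSeries.X := by
  obtain ⟨x, hx0, hxpow, hxC⟩ := exists_unit_pow_orderOf_eq hθ hN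
  refine ⟨SkewLaurent.lift (PowerSeries.C.comp ((Ideal.Quotient.mk _).comp (SkewLaurent.C θ)))
    x hxC, SkewLaurent.lift_C _ x hxC, ?_, ?_⟩
  · rw [SkewLaurent.lift_X, hx0]
  · rw [SkewLaurent.Y, map_pow, SkewLaurent.lift_X, hxpow, SkewLaurent.Y]

theorem nonempty_admissible (hθ : IsOfFinOrder θ) {E : Type*} [Field E] [Algebra (FixedField θ) E]
    {z : E} (hint : IsIntegral (FixedField θ) z) (hz : z ≠ 0) : Nonempty (Admissible θ z) := by
  have : Fact (Irreducible (minpoly (FixedField θ) z)) := ⟨minpoly.irreducible hint⟩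
  have hroot : AdjoinRoot.root (minpoly (FixedField θ) z) ≠ 0 := by
    rw [← AdjoinRoot.mk_X, Ne, AdjoinRoot.mk_eq_zero, minpoly.dvd_iff, aeval_X]
    exact hz
  obtain ⟨Ψ, hC, hX, hY⟩ := exists_ringHom_powerSeries hθ hroot
  have hmod : PowerSeries.constantCoeff.comp Ψ =
      Ideal.Quotient.mk (centralIdeal θ (minpoly (FixedField θ) z)) :=
    SkewLaurent.ringHom_ext (fun a => by rw [RingHom.comp_apply, hC]; simp) hX
  have hN : PowerSeries.constantCoeff (Ψ (SkewLaurent.ofCentral θ (minpoly (FixedField θ) z))) =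
      0 :=
    (RingHom.congr_fun hmod _).trans (mk_ofCentral_eq_zero (minpoly.aeval _ _))
  exact ⟨{
    toRingHom := completionLift Ψ hN
    map_C := fun a => by rw [completionLift_toCompletion, hC]
    map_X := by rw [completionLift_toCompletion, hX]
    map_Y := by rw [completionLift_toCompletion, hY] }⟩

end Existence

section MainTheorem

variable {K : Type*} [Field K] {θ : RingAut K} {Fs : Type*} [Field Fs] [Algebra (FixedField θ) Fs]

theorem PolesSeparable.exists_isReducedFraction {f : SkewFrac θ} (hf : PolesSeparable Fs f) :
    ∃ (g : SkewLaurent θ) (D : nonZeroDivisors (FixedField θ)[X]), f = LocalizedModule.mk g D ∧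
      ((D : (FixedField θ)[X]).map (algebraMap (FixedField θ) Fs)).Splits ∧
      IsReducedFraction g (D : (FixedField θ)[X]) := by
  obtain ⟨g, D, rfl, hs⟩ := hf
  obtain ⟨g', D', hdvd, hmk, hred⟩ := SkewResidue.exists_isReducedFraction g D
  exact ⟨g', D', hmk, hs.of_dvd ((Polynomial.map_ne_zero_iff
    (algebraMap (FixedField θ) Fs).injective).2 (nonZeroDivisors.coe_ne_zero D))
    (Polynomial.map_dvd _ hdvd), hred⟩

theorem finite_support_and_finsum_onePoint {α M : Type*} [AddCommMonoid M] {u : OnePoint α → M}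
    {s : Finset α} (h : ∀ a ∉ s, u a = 0) :
    (Function.support u).Finite ∧ ∑ᶠ p, u p = u OnePoint.infty + ∑ a ∈ s, u a := by
  have hsub : Function.support u ⊆ (Finset.insertNone s : Set (Option α)) := by
    intro p hp
    induction p using OnePoint.rec with
    | infty => exact Finset.none_mem_insertNone
    | coe a => exact Finset.some_mem_insertNone.2 (of_not_not fun ha => hp (h a ha))
  refine ⟨(Finset.finite_toSet _).subset hsub, ?_⟩
  rw [finsum_eq_sum_of_support_subset _ hsub]
  exact Finset.sum_insertNone _ _

variable [IsSepClosure (FixedField θ) Fs] (hθ : IsOfFinOrder θ)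
  (τ : ∀ z : Fs, z ≠ 0 → Admissible θ z) (j : ℕ)

theorem finite_support_and_finsum_partialRes_eq_zero {f : SkewFrac θ} (hf : PolesSeparable Fs f)
    (h : ∀ (z : Fs) (hz : z ≠ 0), ((-1 : ℤ) : WithTop ℤ) ≤ (τ z hz).ord f) :
    (Function.support (partialRes hθ τ j f)).Finite ∧
      ∑ᶠ p : OnePoint Fs, partialRes hθ τ j f p = 0 := by
  classical
  obtain ⟨g, D, rfl, hs, hred⟩ := hf.exists_isReducedFraction
  have h0 := hred.coeff_zero_ne_zero
  have hmem {z : Fs} : z ∈ ((D : (FixedField θ)[X]).aroots Fs).toFinset ↔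
      aeval z (D : (FixedField θ)[X]) = 0 := by
    rw [Multiset.mem_toFinset, mem_aroots, and_iff_right (nonZeroDivisors.coe_ne_zero D)]
  have hzero : (0 : Fs) ∉ ((D : (FixedField θ)[X]).aroots Fs).toFinset := by
    rwa [hmem, aeval_def, eval₂_at_zero, map_eq_zero]
  have hcoe {z : Fs} (hz : z ≠ 0) : partialRes hθ τ j (LocalizedModule.mk g D) (z : OnePoint Fs) =
      (τ z hz).partialRes hθ hz j (LocalizedModule.mk g D) := dif_neg hz
  obtain ⟨hfin, hsum⟩ := finite_support_and_finsum_onePoint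
    (u := partialRes hθ τ j (LocalizedModule.mk g D))
    (s := insert 0 ((D : (FixedField θ)[X]).aroots Fs).toFinset) fun z hz => by
      rw [Finset.mem_insert, not_or, hmem] at hz
      rw [hcoe hz.1, (τ z hz.1).partialRes_eq_zero hθ hz.1 j (h z hz.1) hz.2]
  refine ⟨hfin, hsum.trans ?_⟩
  have hformula := sum_roots_add_partialResZero_add_partialResInfty hθ j g D hs
    (hred.separable hs τ h) h0 (fun z => partialRes hθ τ j (LocalizedModule.mk g D) z)
    fun z hz hroot => by
      rw [hcoe hz, (τ z hz).tmul_aeval_derivative_mul_partialRes hθ hz j (h z hz) hroot]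
  rw [Finset.sum_insert hzero, add_comm, add_comm (partialRes _ _ _ _ ((0 : Fs) : OnePoint Fs)),
    ← hformula]
  exact congrArg₂ _ (congrArg₂ _ rfl (dif_pos rfl)) rfl

end MainTheorem

theorem mainTheorem1_general {K : Type*} [Field K] (θ : RingAut K) (hθ : IsOfFinOrder θ)
    (Fs : Type*) [Field Fs] [Algebra (FixedField θ) Fs] [IsSepClosure (FixedField θ) Fs] :
    (∀ z : Fs, z ≠ 0 → Nonempty (Admissible θ z)) ∧
    ∀ (τ : ∀ z : Fs, z ≠ 0 → Admissible θ z) (f : SkewFrac θ),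
      PolesSeparable Fs f →
      (∀ (z : Fs) (hz : z ≠ 0), ((-1 : ℤ) : WithTop ℤ) ≤ (τ z hz).ord f) →
      ∀ j : ℕ,
        (Function.support (partialRes hθ τ j f)).Finite ∧
        ∑ᶠ p : OnePoint Fs, partialRes hθ τ j f p = 0 :=
  ⟨fun _ hz => nonempty_admissible hθ (Admissible.isIntegral_of_isSepClosure _) hz,
    fun τ _ hf h j => finite_support_and_finsum_partialRes_eq_zero hθ τ j hf h⟩

end SkewResidue

end

open SkewResidue in
theorem mainTheorem1 {K : Type*} [Field K] (θ : RingAut K) (hθ : IsOfFinOrder θ)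
    (Fs : Type*) [Field Fs] [Algebra (FixedField θ) Fs] [IsSepClosure (FixedField θ) Fs] :
    (∀ z : Fs, z ≠ 0 → Nonempty (Admissible θ z)) ∧
    ∀ (τ : ∀ z : Fs, z ≠ 0 → Admissible θ z) (f : SkewFrac θ),
      PolesSeparable Fs f →
      (∀ (z : Fs) (hz : z ≠ 0), ((-1 : ℤ) : WithTop ℤ) ≤ (τ z hz).ord f) →
      ∀ j : ℕ, j < orderOf θ →
        (Function.support (partialRes hθ τ j f)).Finite ∧
        ∑ᶠ p : OnePoint Fs, partialRes hθ τ j f p = 0 := by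
  obtain ⟨hexists, hsum⟩ := mainTheorem1_general θ hθ Fs
  exact ⟨hexists, fun τ f hf h j _ => hsum τ f hf h j⟩
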